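/- All graphs are finite, undirected and simple. Write $G-X$ for the graph obtained from $G$ by deleting the vertices in $X$, $i(G)$ for the number of isolated vertices of $G$, $K_m$ for the complete graph on $m$ vertices, $mK_2$ for the disjoint union of $m$ copies of $K_2$, and $G_1+G_2$ for the join of $G_1$ and $G_2$. A graph is $k$-connected if it has more than $k$ vertices and remains connected after the deletion of any fewer than $k$ vertices. The isolated toughness of $G$ is $I(G)=+\infty$ if $G$ is complete, and otherwise $$I(G)=\min\left\{\frac{|X|}{i(G-X)} : X\subseteq V(G),\ i(G-X)\ge 2\right\}.$$ For $k\ge2$, a $P_{\ge k}$-factor of $G$ is a spanning subgraph of $G$ each of whose components is a path with at least $k$ vertices. $G$ is $(P_{\ge k},n)$-factor critical avoidable if for every $W\subseteq V(G)$ with $|W|=n$ and every edge $e$ of $G-W$, the graph $G-W$ has a $P_{\ge k}$-factor that does not contain $e$. Theorem 8. Let $n,r\ge0$ be integers. (1) If $G$ is an $(n+r+2)$-connected graph with $I(G)>\frac{n+3(r+2)}{2(r+2)}$, then $G$ is $(P_{\ge3},n)$-factor critical avoidable. (2) The strict inequality in (1) cannot be weakened to $\ge$: the graph $G=K_{n+r+2}+(2r+4)K_2$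 is $(n+r+2)$-connected with $I(G)=\frac{n+3(r+2)}{2(r+2)}$, and it is not $(P_{\ge3},n)$-factor critical avoidable. (3) The connectivity in (1) cannot be lowered to $n+r+1$ when $n\ge1$: in that case the graph $G=K_{n+r+1}+(2r+2)K_2$ is $(n+r+1)$-connected with $I(G)>\frac{n+3(r+2)}{2(r+2)}$, and it is not $(P_{\ge3},n)$-factor critical avoidable. -/

import Mathlib

namespace PathFactor

open SimpleGraph

/-- `G` is `k`-connected: it has more than `k` vertices, and deleting fewer than `k` vertices
never disconnects it. -/
def IsKConnected {V : Type*} (k : ℕ) (G : SimpleGraph V) : Prop :=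
  k < Nat.card V ∧ ∀ X : Set V, X.ncard < k → (G.induce Xᶜ).Connected

/-- `i(G)`, the number of isolated vertices of `G`. -/
noncomputable def numIsolated {V : Type*} (G : SimpleGraph V) : ℕ :=
  {v : V | G.IsIsolated v}.ncard

open Classical in
/-- The isolated toughness `I(G)`: `+∞` for a complete graph, and otherwise the least value of
`|X| / i(G - X)` over the vertex sets `X` with `i(G - X) ≥ 2`. -/
noncomputable def isolatedToughness {V : Type*} (G : SimpleGraph V) : EReal :=
  if G = ⊤ then ⊤
  else ⨅ (X : Set V) (_ : 2 ≤ numIsolated (G.induce Xᶜ)),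
    (((X.ncard : ℝ) / (numIsolated (G.induce Xᶜ) : ℝ) : ℝ) : EReal)

/-- `F` is a `P_{≥k}`-factor of `G`: a spanning subgraph of `G` each of whose components is a path
of order at least `2` and at least `k`. -/
def IsPathFactor {V : Type*} (k : ℕ) (G F : SimpleGraph V) : Prop :=
  F ≤ G ∧ ∀ C : F.ConnectedComponent,
    ∃ m : ℕ, 2 ≤ m ∧ k ≤ m ∧ Nonempty (C.toSimpleGraph ≃g pathGraph m)

/-- `G` is `P_{≥k}`-factor avoidable: for each edge `e` of `G` there is a `P_{≥k}`-factor of `G`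
that does not use `e`. -/
def IsFactorAvoidable {V : Type*} (k : ℕ) (G : SimpleGraph V) : Prop :=
  ∀ e ∈ G.edgeSet, ∃ F : SimpleGraph V, IsPathFactor k G F ∧ e ∉ F.edgeSet

/-- `G` is `(P_{≥k}, n)`-factor critical avoidable: `G - W` is `P_{≥k}`-factor avoidable for every
set `W` of `n` vertices. -/
def IsFactorCriticalAvoidable {V : Type*} (k n : ℕ) (G : SimpleGraph V) : Prop :=
  ∀ W : Finset V, W.card = n → IsFactorAvoidable k (G.induce ((W : Set V)ᶜ))

/-- The join of two graphs: their disjoint union together with all edges between them. -/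
def join {V W : Type*} (G : SimpleGraph V) (H : SimpleGraph W) : SimpleGraph (V ⊕ W) where
  Adj
    | Sum.inl u, Sum.inl v => G.Adj u v
    | Sum.inr u, Sum.inr v => H.Adj u v
    | _, _ => True
  symm.symm
    | Sum.inl _, Sum.inl _ => G.adj_symm
    | Sum.inr _, Sum.inr _ => H.adj_symm
    | Sum.inl _, Sum.inr _ | Sum.inr _, Sum.inl _ => id
  loopless.irrefl
    | Sum.inl u => G.loopless.irrefl u
    | Sum.inr u => H.loopless.irrefl u

/-- `m K₂`, the disjoint union of `m` copies of `K₂`. -/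
def copiesK2 (m : ℕ) : SimpleGraph (Fin m × Fin 2) :=
  (⊥ : SimpleGraph (Fin m)) □ (⊤ : SimpleGraph (Fin 2))

/-- `K_a + m K₂`, the join of `K_a` and `m` disjoint copies of `K₂`. -/
def completeJoinK2 (a m : ℕ) : SimpleGraph (Fin a ⊕ Fin m × Fin 2) :=
  join (⊤ : SimpleGraph (Fin a)) (copiesK2 m)

end PathFactor

namespace PathFactor

open SimpleGraph

set_option linter.unusedSectionVars false

/-! Part (1) rests on Kaneko's criterion, proved here as `pathCoverable_of_sunCondition`: a graph
has a `P_{≥3}`-factor if every vertex set `S` leaves at most `2|S|` sun components. Suppose `G - W -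
e` violates this at `S`. Connectivity forces `|S| ≥ r + 2` (`IsKConnected.le_card_of_suns`): after
fewer deletions `G - W - S` is connected, yet restoring one edge cannot connect three suns, and `S =
∅` is excluded because every vertex of `G - W` has two neighbours. Now let `I` collect the leaves of
the suns and let `Y` consist of `W`, `S` and the bases. Then `|I| ≥ 2|S|` and `|Y| ≤ n + |S| + |I|`,
so `I(G) ≤ |Y|/|I| ≤ 1 + (n + |S|)/(2|S|) ≤ 3/2 + n/(2(r + 2))`, against the hypothesis. The ends of
`e` need separate care (`not_lt_isolatedToughness_of_suns`).

Kaneko's criterion is proved by induction on vertices, then on edges. Every sun can be covered but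
for a path starting at any prescribed vertex, so a vertex joined to two suns absorbs both. If a
nonempty `S` attains equality, Hall's theorem assigns each of its vertices two suns, and the rest is
covered by induction (`pathCoverable_of_tight`). Otherwise the condition is strict for nonempty
sets. Deleting an edge either preserves the condition, and induction applies, or creates suns at its
ends; in an uncoverable graph this forces every vertex with two neighbours to have a pendant
neighbour. The whole graph is then the corona of a factor-critical graph, hence itself a sun, which
contradicts the condition for `S = ∅`.

Parts (2) and (3) are counting. Delete `n` vertices of the clique and forbid the edge of one `K₂`:
the remaining `s` clique vertices must serve `2s + 1` small pieces, but each has degree at most two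
in a path factor. -/

variable {V : Type*} [DecidableEq V] {G : SimpleGraph V}

/-! ### Path coverings and perfect matchings of finite vertex sets -/

/-- `l` lists the vertices of a path of `G`, in order. -/
def IsPathList (G : SimpleGraph V) (l : List V) : Prop :=
  l.IsChain G.Adj ∧ l.Nodup

lemma IsPathList.reverse {l : List V} (h : IsPathList G l) : IsPathList G l.reverse := by
  refine ⟨?_, List.nodup_reverse.2 h.2⟩
  rw [List.isChain_reverse]
  exact h.1.imp fun a b hab => hab.symm

lemma IsPathList.join {u v : V} {p q : List V} (hp : IsPathList G (u :: p))
    (hq : IsPathList G (v :: q)) (huv : G.Adj u v) (hd : ∀ z ∈ u :: p, z ∉ v :: q) :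
    IsPathList G ((u :: p).reverse ++ v :: q) := by
  refine ⟨?_, ?_⟩
  · rw [List.isChain_append]
    refine ⟨hp.reverse.1, hq.1, ?_⟩
    intro x hx y hy
    rw [List.getLast?_reverse] at hx
    simp only [List.head?_cons, Option.mem_def, Option.some.injEq] at hx hy
    subst hx hy
    exact huv
  · rw [List.nodup_append]
    refine ⟨hp.reverse.2, hq.2, ?_⟩
    rintro a ha b hb rfl
    exact hd a (List.mem_reverse.1 ha) hb

/-- The set `A` can be partitioned into the vertex sets of paths of `G` of order at least `3`. -/
inductive PathCoverable (G : SimpleGraph V) : Finset V → Prop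
  | empty : PathCoverable G ∅
  | cons {l : List V} {A : Finset V} : IsPathList G l → 3 ≤ l.length → Disjoint l.toFinset A →
      PathCoverable G A → PathCoverable G (l.toFinset ∪ A)

lemma PathCoverable.of_path {A B : Finset V} (hB : PathCoverable G B) {l : List V}
    (hl : IsPathList G l) (h3 : 3 ≤ l.length) (hd : ∀ z ∈ l, z ∉ B)
    (hA : ∀ z, z ∈ A ↔ z ∈ l ∨ z ∈ B) : PathCoverable G A := by
  have : A = l.toFinset ∪ B := by ext z; simp [hA]
  rw [this]
  refine .cons hl h3 ?_ hB
  rw [Finset.disjoint_left]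
  simpa using hd

lemma PathCoverable.union {A B : Finset V} (hA : PathCoverable G A) (hB : PathCoverable G B)
    (hd : Disjoint A B) : PathCoverable G (A ∪ B) := by
  induction hA with
  | empty => simpa using hB
  | @cons l A hl h3 hlA _ ih =>
    rw [Finset.disjoint_union_left] at hd
    rw [Finset.union_assoc]
    exact .cons hl h3 (Finset.disjoint_union_right.2 ⟨hlA, hd.1⟩) (ih hd.2)

lemma PathCoverable.biUnion {ι : Type*} [DecidableEq ι] (s : Finset ι) (f : ι → Finset V)
    (h : ∀ i ∈ s, PathCoverable G (f i))
    (hd : ∀ i ∈ s, ∀ j ∈ s, i ≠ j → Disjoint (f i) (f j)) : PathCoverable G (s.biUnion f) := by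
  induction s using Finset.induction_on with
  | empty => simpa using PathCoverable.empty
  | insert a s ha ih =>
    rw [Finset.biUnion_insert]
    refine (h a (by simp)).union (ih (fun i hi => h i (by simp [hi])) fun i hi j hj =>
      hd i (by simp [hi]) j (by simp [hj])) ?_
    rw [Finset.disjoint_biUnion_right]
    intro i hi
    exact hd a (by simp) i (by simp [hi]) (by rintro rfl; exact ha hi)

lemma PathCoverable.mono {H : SimpleGraph V} (hGH : G ≤ H) {A : Finset V}
    (h : PathCoverable G A) : PathCoverable H A := by
  induction h with
  | empty => exact .empty
  | cons hl h3 hd _ ih => exact .cons ⟨hl.1.imp fun _ _ hab => hGH hab, hl.2⟩ h3 hd ih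

/-- The subgraph of `G` induced by `M` has a perfect matching. -/
inductive PerfectlyMatched (G : SimpleGraph V) : Finset V → Prop
  | empty : PerfectlyMatched G ∅
  | cons {r r' : V} {M : Finset V} : G.Adj r r' → r ∉ M → r' ∉ M → PerfectlyMatched G M →
      PerfectlyMatched G (insert r (insert r' M))

lemma PerfectlyMatched.mono {H : SimpleGraph V} {M : Finset V}
    (hGH : ∀ u ∈ M, ∀ v ∈ M, G.Adj u v → H.Adj u v)
    (h : PerfectlyMatched G M) : PerfectlyMatched H M := by
  induction h with
  | empty => exact .empty
  | cons ha h1 h2 _ ih =>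
    exact .cons (hGH _ (by simp) _ (by simp) ha) h1 h2
      (ih fun u hu v hv => hGH u (by simp [hu]) v (by simp [hv]))

lemma PerfectlyMatched.exists_mate {M : Finset V} (h : PerfectlyMatched G M) {r : V}
    (hr : r ∈ M) : ∃ r' M', G.Adj r r' ∧ r ∉ M' ∧ r' ∉ M' ∧ PerfectlyMatched G M' ∧
      M = insert r (insert r' M') := by
  induction h with
  | empty => simp at hr
  | @cons a b M hab ha hb hM ih =>
    by_cases h1 : r = a
    · subst h1; exact ⟨b, M, hab, ha, hb, hM, rfl⟩
    by_cases h2 : r = b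
    · subst h2; exact ⟨a, M, hab.symm, hb, ha, hM, Finset.insert_comm _ _ _⟩
    have hrM : r ∈ M := by simpa [h1, h2] using hr
    obtain ⟨r', M', h3, h4, h5, h6, rfl⟩ := ih hrM
    simp only [Finset.mem_insert, not_or] at ha hb
    refine ⟨r', insert a (insert b M'), h3, ?_, ?_, .cons hab ha.2.2 hb.2.2 h6, ?_⟩
    · simp [h1, h2, h4]
    · simp [h5, Ne.symm ha.2.1, Ne.symm hb.2.1]
    · ext z; simp only [Finset.mem_insert]; tauto

/-! ### Suns, coronas and how they absorb hanging paths -/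

/-- `D` is closed in `A`: no edge of `G` joins `D` to a vertex of `A` outside `D`. -/
def ClosedIn (G : SimpleGraph V) (A D : Finset V) : Prop :=
  ∀ u ∈ D, ∀ w ∈ A, G.Adj u w → w ∈ D

/-- The subgraph induced by `A` has no proper nonempty closed part. -/
def ConnectedOn (G : SimpleGraph V) (A : Finset V) : Prop :=
  ∀ D ⊆ A, D.Nonempty → ClosedIn G A D → D = A

/-- `D` induces the corona of the factor-critical graph induced by `R`; the pendant vertex at
`r ∈ R` is `σ r`. -/
structure IsCorona (G : SimpleGraph V) (D R : Finset V) (σ : V → V) : Prop where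
  nonempty : R.Nonempty
  mem_iff : ∀ z, z ∈ D ↔ z ∈ R ∨ ∃ r ∈ R, σ r = z
  inj : ∀ r ∈ R, ∀ s ∈ R, σ r = σ s → r = s
  notMem : ∀ r ∈ R, σ r ∉ R
  adj : ∀ r ∈ R, G.Adj r (σ r)
  leaf : ∀ r ∈ R, ∀ z ∈ D, G.Adj (σ r) z → z = r
  crit : ∀ r ∈ R, PerfectlyMatched G (R.erase r)

/-- A sun: a single vertex, or a `K₂`, or the corona of a factor-critical graph. -/
def IsSun (G : SimpleGraph V) (D : Finset V) : Prop :=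
  ConnectedOn G D ∧ ((∃ v, D = {v}) ∨ ∃ R σ, IsCorona G D R σ)

namespace IsCorona

variable {D R : Finset V} {σ : V → V}

lemma ne_leaf (h : IsCorona G D R σ) {r s : V} (hr : r ∈ R) (hs : s ∈ R) : r ≠ σ s :=
  fun e => h.notMem s hs (e ▸ hr)

/-- The pairs over a perfectly matched part of the base can be covered by paths of order `4`. -/
lemma pathCoverable_pairs (h : IsCorona G D R σ) {M : Finset V} (hM : PerfectlyMatched G M)
    (hMR : M ⊆ R) : PathCoverable G (M ∪ M.image σ) := by
  induction hM with
  | empty => simpa using PathCoverable.empty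
  | @cons r r' M hrr' hr hr' _ ih =>
    have h1 : r ∈ R := hMR (by simp)
    have h2 : r' ∈ R := hMR (by simp)
    have hM' : M ⊆ R := fun z hz => hMR (by simp [hz])
    have hne := hrr'.ne
    refine (ih hM').of_path (l := [σ r, r, r', σ r']) ⟨?_, ?_⟩ (by simp) ?_ ?_
    · simp [hrr', h.adj r' h2, (h.adj r h1).symm]
    · have := h.inj r h1 r' h2
      have := h.ne_leaf h1 h1
      have := h.ne_leaf h1 h2
      have := h.ne_leaf h2 h1
      have := h.ne_leaf h2 h2
      simp; grind
    · have := h.inj r h1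
      have := h.inj r' h2
      have := h.notMem
      intro z hz
      simp at hz
      simp
      grind
    · intro z; simp; grind

/-- A path through the pairs over some vertices of the base extends by a perfect matching of the
remaining ones to a covering. -/
lemma cover (h : IsCorona G D R σ) {M : Finset V} (hM : PerfectlyMatched G M) (hMR : M ⊆ R)
    {B : Finset V} (hB : PathCoverable G B) (A : Finset V)
    (hBM : ∀ z ∈ B, z ∉ M ∧ ∀ r ∈ M, σ r ≠ z)
    (hA : ∀ z, z ∈ A ↔ z ∈ B ∨ z ∈ M ∨ ∃ r ∈ M, σ r = z) : PathCoverable G A := by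
  have : A = B ∪ (M ∪ M.image σ) := by ext z; simp [hA]
  rw [this]
  refine hB.union (h.pathCoverable_pairs hM hMR) ?_
  rw [Finset.disjoint_left]
  intro z hz
  have := hBM z hz
  simp; grind

end IsCorona

lemma PathCoverable.single {l : List V} (hl : IsPathList G l) (h3 : 3 ≤ l.length) :
    PathCoverable G l.toFinset :=
  PathCoverable.empty.of_path hl h3 (by simp) (by simp)

lemma PathCoverable.pair {l l' : List V} (hl : IsPathList G l) (h3 : 3 ≤ l.length)
    (hl' : IsPathList G l') (h3' : 3 ≤ l'.length) (hd : ∀ z ∈ l, z ∉ l') :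
    PathCoverable G (l ++ l').toFinset :=
  (PathCoverable.single hl' h3').of_path hl h3 (by simpa using hd) (by simp)

/-- A path starting at `v` can be removed from `D` so that the rest is path coverable. -/
def HangsAt (G : SimpleGraph V) (D : Finset V) (v : V) : Prop :=
  ∃ b, IsPathList G (v :: b) ∧ (∀ z ∈ v :: b, z ∈ D) ∧ PathCoverable G (D \ (v :: b).toFinset)

lemma isPathList_singleton (v : V) : IsPathList G [v] := by simp [IsPathList]

lemma isPathList_pair {u v : V} (h : G.Adj u v) : IsPathList G [u, v] := by
  simp [IsPathList, h, h.ne]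

lemma IsPathList.cons {x y : V} {p : List V} (hp : IsPathList G (y :: p)) (hxy : G.Adj x y)
    (hx : x ∉ y :: p) : IsPathList G (x :: y :: p) :=
  ⟨List.isChain_cons_cons.2 ⟨hxy, hp.1⟩, List.nodup_cons.2 ⟨hx, hp.2⟩⟩

namespace IsCorona

variable {D R : Finset V} {σ : V → V}

lemma mem_base (h : IsCorona G D R σ) {r : V} (hr : r ∈ R) : r ∈ D := (h.mem_iff r).2 (.inl hr)

lemma mem_leaf (h : IsCorona G D R σ) {r : V} (hr : r ∈ R) : σ r ∈ D :=
  (h.mem_iff _).2 (.inr ⟨r, hr, rfl⟩)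

lemma pathCoverable_erase_pair (h : IsCorona G D R σ) {r : V} (hr : r ∈ R) {A : Finset V}
    (hA : ∀ z, z ∈ A ↔ z ∈ D ∧ z ≠ r ∧ z ≠ σ r) : PathCoverable G A := by
  refine h.cover (h.crit r hr) (Finset.erase_subset _ _) .empty A (by simp) ?_
  intro z
  have h1 := h.inj r hr
  have h2 := h.notMem
  rw [hA, h.mem_iff]
  simp; grind

/-- Whether `v` is a base vertex or a leaf, its partner completes a path of order two, and
factor-criticality matches the rest of the base. -/
lemma hangsAt (h : IsCorona G D R σ) {v : V} (hv : v ∈ D) : HangsAt G D v := by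
  rcases (h.mem_iff v).1 hv with hr | ⟨r, hr, rfl⟩
  · refine ⟨[σ v], isPathList_pair (h.adj v hr), ?_, ?_⟩
    · simp [hv, h.mem_leaf hr]
    · exact h.pathCoverable_erase_pair hr (by simp)
  · refine ⟨[r], isPathList_pair (h.adj r hr).symm, ?_, ?_⟩
    · simp [hv, h.mem_base hr]
    · exact h.pathCoverable_erase_pair hr (by simp; grind)

/-- Every other base vertex `r` has a mate in a perfect matching of the base without `x`. -/
lemma exists_mate (h : IsCorona G D R σ) {x r : V} (hx : x ∈ R) (hr : r ∈ R) (hne : r ≠ x) :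
    ∃ s M, s ∈ R ∧ G.Adj r s ∧ s ≠ x ∧ x ∉ M ∧ r ∉ M ∧ s ∉ M ∧ M ⊆ R ∧ PerfectlyMatched G M ∧
      ∀ z, z ∈ R ↔ z = x ∨ z = r ∨ z = s ∨ z ∈ M := by
  obtain ⟨s, M, h1, h2, h3, h4, h5⟩ := (h.crit x hx).exists_mate (r := r) (by simp [hne, hr])
  have h6 : ∀ z, (z ≠ x ∧ z ∈ R) ↔ (z = r ∨ z = s ∨ z ∈ M) := by
    intro z; rw [← Finset.mem_erase, h5]; simp
  refine ⟨s, M, ((h6 s).2 (by simp)).2, h1, ((h6 s).2 (by simp)).1, ?_, h2, h3, ?_, h4, ?_⟩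
  · exact fun hxM => ((h6 x).2 (by simp [hxM])).1 rfl
  · exact fun z hz => ((h6 z).2 (by simp [hz])).2
  · intro z
    by_cases hz : z = x
    · simp [hz, hx]
    · rw [← h6 z]; simp [hz]

/-- Two critical matchings give `r` two distinct base neighbours: `s`, its mate when `x` is removed,
and `t`, its mate when `s` is removed. The path `σ s, s, r, t, σ t` absorbs `r` without its leaf. -/
lemma pathCoverable_erase_leaf (h : IsCorona G D R σ) {r : V} (hr : r ∈ R) (hR : R ≠ {r}) :
    PathCoverable G (D.erase (σ r)) := by
  obtain ⟨x, hx, hxr⟩ : ∃ x ∈ R, x ≠ r := by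
    by_contra! hc
    exact hR (Finset.eq_singleton_iff_unique_mem.2 ⟨hr, hc⟩)
  obtain ⟨s, -, hs, hrs, -⟩ := h.exists_mate hx hr hxr.symm
  obtain ⟨t, M, ht, hrt, hts, hsM, hrM, htM, hMR, hM, hall⟩ := h.exists_mate hs hr hrs.ne
  have i1 := h.inj r hr
  have i2 := h.inj s hs
  have i3 := h.inj t ht
  have n1 := h.notMem
  have e1 := hrs.ne
  have e2 := hrt.ne
  refine h.cover hM hMR (PathCoverable.single (l := [σ s, s, r, t, σ t]) ⟨?_, ?_⟩ (by simp)) _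
    ?_ ?_
  · simp [hrs.symm, hrt, h.adj t ht, (h.adj s hs).symm]
  · simp; grind
  · intro z hz; simp at hz; grind
  · intro z
    rw [Finset.mem_erase, h.mem_iff]
    simp; grind

section TwoHang

variable {y s : V} {p q : List V}

/-- A path hanging from a base vertex and another one hanging from a leaf are absorbed. -/
lemma pathCoverable_of_hang_base_leaf (h : IsCorona G D R σ) {x r : V} (hx : x ∈ R) (hr : r ∈ R)
    (hp : IsPathList G (y :: p)) (hq : IsPathList G (s :: q)) (hpD : ∀ z ∈ y :: p, z ∉ D)
    (hqD : ∀ z ∈ s :: q, z ∉ D) (hpq : ∀ z ∈ y :: p, z ∉ s :: q) (hxy : G.Adj x y)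
    (hrs : G.Adj (σ r) s) :
    PathCoverable G (D ∪ (y :: p).toFinset ∪ (s :: q).toFinset) := by
  have n1 := h.notMem
  have m1 := h.mem_base hx
  have m2 := h.mem_leaf hx
  have m3 := h.mem_base hr
  have m4 := h.mem_leaf hr
  -- Over a common pair, one path runs through both hanging paths. Otherwise `r` has a mate `t` once
  -- `x` is removed; one path ends in `σ r, r, t, σ t` and the other in `x, σ x`.
  by_cases hrx : r = x
  · subst hrx
    have j1 : IsPathList G (r :: y :: p) :=
      hp.cons hxy (by grind)
    have j2 : IsPathList G (σ r :: r :: y :: p) :=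
      j1.cons (h.adj r hr).symm (by have := h.ne_leaf hr hr; simp; grind)
    have j3 := hq.join j2 hrs.symm (by simp; grind)
    refine (h.pathCoverable_erase_pair hr (A := (D.erase r).erase (σ r)) (by simp; grind)).of_path
      j3 (by simp; omega) ?_ ?_
    · intro z; simp; grind
    · intro z; simp; grind
  · obtain ⟨t, M, ht, hrt, htx, hxM, hrM, htM, hMR, hM, hall⟩ := h.exists_mate hx hr hrx
    have m5 := h.mem_base ht
    have m6 := h.mem_leaf ht
    have i1 := h.inj r hr
    have i2 := h.inj x hx
    have i3 := h.inj t ht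
    have e1 := hrt.ne
    have j1 : IsPathList G [σ r, r, t, σ t] := by
      refine ⟨by simp [hrt, h.adj t ht, (h.adj r hr).symm], by simp; grind⟩
    have j2 := hq.join j1 hrs.symm (by simp; grind)
    have j3 := hp.join (isPathList_pair (h.adj x hx)) hxy.symm (by simp; grind)
    refine h.cover hM hMR (PathCoverable.pair j2 (by simp) j3 (by simp) (by simp; grind)) _ ?_ ?_
    · intro z hz
      have m7 : ∀ r ∈ M, r ∈ D ∧ σ r ∈ D := fun r hr => ⟨h.mem_base (hMR hr), h.mem_leaf (hMR hr)⟩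
      simp at hz
      grind
    · intro z
      simp only [Finset.mem_union, List.mem_toFinset, List.mem_append, List.mem_reverse,
        h.mem_iff]
      simp; grind

/-- A path hanging from a leaf and another one hanging from any vertex are absorbed, unless the
corona is a `K₂`. -/
lemma pathCoverable_of_hang_leaf (h : IsCorona G D R σ) {r v : V} (hr : r ∈ R) (hR : R ≠ {r})
    (hv : v ∈ D)
    (hp : IsPathList G (y :: p)) (hq : IsPathList G (s :: q)) (hpD : ∀ z ∈ y :: p, z ∉ D)
    (hqD : ∀ z ∈ s :: q, z ∉ D) (hpq : ∀ z ∈ y :: p, z ∉ s :: q) (hxy : G.Adj (σ r) y)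
    (hvs : G.Adj v s) :
    PathCoverable G (D ∪ (y :: p).toFinset ∪ (s :: q).toFinset) := by
  have m1 := h.mem_base hr
  have m2 := h.mem_leaf hr
  rcases (h.mem_iff v).1 hv with hvR | ⟨x, hx, rfl⟩
  · have := h.pathCoverable_of_hang_base_leaf hvR hr hq hp hqD hpD (by grind) hvs hxy
    rwa [Finset.union_right_comm] at this
  -- At a common leaf, the leaf links the two paths, and `R ≠ {r}` makes the rest of the corona
  -- coverable.
  by_cases hrx : x = r
  · subst hrx
    have j1 : IsPathList G (σ x :: y :: p) :=
      hp.cons hxy (by grind)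
    have j2 := hq.join j1 hvs.symm (by simp; grind)
    refine (h.pathCoverable_erase_leaf hr hR).of_path j2 (by simp; omega) ?_ ?_
    · intro z; simp; grind
    · intro z; simp; grind
  · obtain ⟨t, M, ht, hrt, htx, hxM, hrM, htM, hMR, hM, hall⟩ :=
      h.exists_mate hx hr (Ne.symm hrx)
    have n1 := h.notMem
    have m3 := h.mem_base hx
    have m4 := h.mem_leaf hx
    have m5 := h.mem_base ht
    have m6 := h.mem_leaf ht
    have i1 := h.inj r hr
    have i2 := h.inj x hx
    have i3 := h.inj t ht
    have e1 := hrt.ne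
    have j1 : IsPathList G [σ r, r, t, σ t] := by
      refine ⟨by simp [hrt, h.adj t ht, (h.adj r hr).symm], by simp; grind⟩
    have j2 := hp.join j1 hxy.symm (by simp; grind)
    have j3 := hq.join (isPathList_pair (h.adj x hx).symm) hvs.symm (by simp; grind)
    refine h.cover hM hMR (PathCoverable.pair j2 (by simp) j3 (by simp) (by simp; grind)) _ ?_ ?_
    · intro z hz
      have m7 : ∀ r ∈ M, r ∈ D ∧ σ r ∈ D := fun r hr => ⟨h.mem_base (hMR hr), h.mem_leaf (hMR hr)⟩
      simp at hz
      grind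
    · intro z
      simp only [Finset.mem_union, List.mem_toFinset, List.mem_append, List.mem_reverse,
        h.mem_iff]
      simp; grind

end TwoHang

/-- A `K₂` may be regarded as a corona with either of its vertices as the base. -/
lemma swap (h : IsCorona G D R σ) {r : V} (hr : R = {r}) :
    IsCorona G D {σ r} (fun _ => r) := by
  subst hr
  have hm : ∀ z, z ∈ D ↔ z = r ∨ z = σ r := by intro z; rw [h.mem_iff]; simp [eq_comm]
  have ha := h.adj r (by simp)
  refine ⟨by simp, ?_, by simp, ?_, ?_, ?_, ?_⟩
  · intro z; rw [hm]; simp; tauto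
  · simpa using ha.ne
  · simpa using ha.symm
  · intro z hz x hx hrx
    rcases (hm x).1 hx with rfl | rfl
    · exact (G.irrefl hrx).elim
    · exact (Finset.mem_singleton.1 hz).symm
  · simpa using PerfectlyMatched.empty

/-- Any vertex is a base vertex for a suitable choice of the base, or it is a leaf of a corona
other than `K₂`. -/
lemma base_or_leaf (h : IsCorona G D R σ) {x : V} (hx : x ∈ D) :
    (∃ R σ, IsCorona G D R σ ∧ x ∈ R) ∨ ∃ R σ, IsCorona G D R σ ∧ ∃ r ∈ R, x = σ r ∧ R ≠ {r} := by
  rcases (h.mem_iff x).1 hx with hr | ⟨r, hr, rfl⟩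
  · exact .inl ⟨R, σ, h, hr⟩
  · by_cases hR : R = {r}
    · exact .inl ⟨_, _, h.swap hR, by simp⟩
    · exact .inr ⟨R, σ, h, r, hr, rfl, hR⟩

lemma congr (h : IsCorona G D R σ) {H : SimpleGraph V}
    (hGH : ∀ u ∈ D, ∀ v ∈ D, G.Adj u v ↔ H.Adj u v) : IsCorona H D R σ where
  nonempty := h.nonempty
  mem_iff := h.mem_iff
  inj := h.inj
  notMem := h.notMem
  adj r hr := (hGH _ (h.mem_base hr) _ (h.mem_leaf hr)).1 (h.adj r hr)
  leaf r hr z hz ha := h.leaf r hr z hz ((hGH _ (h.mem_leaf hr) _ hz).2 ha)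
  crit r hr := (h.crit r hr).mono fun u hu v hv =>
    (hGH u (h.mem_base (Finset.mem_of_mem_erase hu)) v (h.mem_base (Finset.mem_of_mem_erase hv))).1

/-- A corona to which an edge is added at a leaf is path coverable. -/
lemma pathCoverable_of_extra_edge {H : SimpleGraph V} (h : IsCorona G D R σ) (hGH : G ≤ H)
    {r y : V} (hr : r ∈ R) (hy : y ∈ D) (hyr : y ≠ r) (ha : H.Adj (σ r) y) :
    PathCoverable H D := by
  have n1 := h.notMem
  have c1 : ∀ M, PerfectlyMatched G M → PerfectlyMatched H M :=
    fun M hM => hM.mono fun _ _ _ _ h => hGH h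
  rcases (h.mem_iff y).1 hy with hyR | ⟨x, hx, rfl⟩
  -- The new edge lets `σ r` be covered together with `y`, so `r` can join its mate `t` without its
  -- own leaf.
  · obtain ⟨t, M, ht, hrt, htx, hxM, hrM, htM, hMR, hM, hall⟩ := h.exists_mate hyR hr hyr.symm
    have i1 := h.inj r hr
    have i2 := h.inj y hyR
    have i3 := h.inj t ht
    have e1 := hrt.ne
    have j1 : IsPathList H [r, t, σ t] :=
      ⟨by simp [hGH hrt, hGH (h.adj t ht)], by simp; grind⟩
    have j2 : IsPathList H [σ y, y, σ r] :=
      ⟨by simp [ha.symm, (hGH (h.adj y hyR)).symm], by simp; grind⟩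
    have hc := (h.pathCoverable_pairs hM hMR).mono hGH
    have := (PathCoverable.pair j1 (by simp) j2 (by simp) (by simp; grind)).union hc (by
      rw [Finset.disjoint_left]; intro z; simp; grind)
    convert this using 1
    ext z
    rw [h.mem_iff]; simp; grind
  · by_cases hxr : x = r
    · subst hxr; exact (H.irrefl ha).elim
    obtain ⟨t, M, ht, hrt, htx, hxM, hrM, htM, hMR, hM, hall⟩ := h.exists_mate hr hx hxr
    have i1 := h.inj r hr
    have i2 := h.inj x hx
    have i3 := h.inj t ht
    have e1 := hrt.ne
    have j1 : IsPathList H [σ t, t, x, σ x, σ r, r] :=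
      ⟨by simp [(hGH hrt).symm, (hGH (h.adj t ht)).symm, hGH (h.adj x hx), ha.symm,
        (hGH (h.adj r hr)).symm], by simp; grind⟩
    have hc := (h.pathCoverable_pairs hM hMR).mono hGH
    refine hc.of_path j1 (by simp) (by simp; grind) ?_
    intro z
    rw [h.mem_iff]; simp; grind

end IsCorona

lemma ConnectedOn.congr {D : Finset V} {H : SimpleGraph V} (h : ConnectedOn G D)
    (hGH : ∀ u ∈ D, ∀ v ∈ D, G.Adj u v ↔ H.Adj u v) : ConnectedOn H D := fun B hB hne hc =>
  h B hB hne fun u hu w hw ha => hc u hu w hw ((hGH u (hB hu) w hw).1 ha)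

namespace IsSun

variable {D : Finset V}

lemma congr (h : IsSun G D) {H : SimpleGraph V}
    (hGH : ∀ u ∈ D, ∀ v ∈ D, G.Adj u v ↔ H.Adj u v) : IsSun H D := by
  refine ⟨h.1.congr hGH, ?_⟩
  rcases h.2 with h1 | ⟨R, σ, h1⟩
  · exact .inl h1
  · exact .inr ⟨R, σ, h1.congr hGH⟩

lemma nonempty (h : IsSun G D) : D.Nonempty := by
  rcases h.2 with ⟨v, rfl⟩ | ⟨R, σ, h1⟩
  · simp
  · obtain ⟨r, hr⟩ := h1.nonempty
    exact ⟨r, h1.mem_base hr⟩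

lemma hangsAt (h : IsSun G D) {v : V} (hv : v ∈ D) : HangsAt G D v := by
  rcases h.2 with ⟨u, rfl⟩ | ⟨R, σ, h1⟩
  · rw [Finset.mem_singleton] at hv
    subst hv
    exact ⟨[], isPathList_singleton _, by simp, by simpa using PathCoverable.empty⟩
  · exact h1.hangsAt hv

end IsSun

lemma isSun_singleton (v : V) : IsSun G {v} :=
  ⟨fun D hD hne _ => by
    rcases Finset.subset_singleton_iff.1 hD with rfl | rfl
    · simp at hne
    · rfl, .inl ⟨v, rfl⟩⟩

/-! ### Sun components and Hall's theorem -/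

open Classical in
/-- The sun components of the subgraph induced by `A`. -/
noncomputable def suns (G : SimpleGraph V) (A : Finset V) : Finset (Finset V) :=
  A.powerset.filter fun D => IsSun G D ∧ ClosedIn G A D

lemma mem_suns {A D : Finset V} : D ∈ suns G A ↔ D ⊆ A ∧ IsSun G D ∧ ClosedIn G A D := by
  simp [suns]

/-- A nonempty intersection is closed in both suns, so by connectedness it equals each of them. -/
lemma suns_disjoint {A D E : Finset V} (hD : D ∈ suns G A) (hE : E ∈ suns G A) (hne : D ≠ E) :
    Disjoint D E := by
  rw [mem_suns] at hD hE
  by_contra hc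
  rw [Finset.not_disjoint_iff_nonempty_inter] at hc
  have h1 := hD.2.1.1 (D ∩ E) Finset.inter_subset_left hc fun u hu w hw ha =>
    Finset.mem_inter.2 ⟨hw, hE.2.2 u (Finset.mem_inter.1 hu).2 w (hD.1 hw) ha⟩
  have h2 := hE.2.1.1 (D ∩ E) Finset.inter_subset_right hc fun u hu w hw ha =>
    Finset.mem_inter.2 ⟨hD.2.2 u (Finset.mem_inter.1 hu).1 w (hE.1 hw) ha, hw⟩
  exact hne (h1.symm.trans h2)

lemma suns_eq_of_mem {A D E : Finset V} (hD : D ∈ suns G A) (hE : E ∈ suns G A) {z : V}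
    (hzD : z ∈ D) (hzE : z ∈ E) : D = E := by
  by_contra hne
  exact Finset.disjoint_left.1 (suns_disjoint hD hE hne) hzD hzE

/-- Deleting a set `S` of vertices leaves at most `2|S|` sun components. -/
def SunCondition (G : SimpleGraph V) (A : Finset V) : Prop :=
  ∀ S ⊆ A, (suns G (A \ S)).card ≤ 2 * S.card

/-- A vertex adjacent to two sets absorbs the paths hanging from them. -/
lemma HangsAt.pathCoverable_insert {D E : Finset V} {s v w : V} (hD : HangsAt G D v)
    (hE : HangsAt G E w) (hDE : Disjoint D E) (hsD : s ∉ D) (hsE : s ∉ E) (hsv : G.Adj s v)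
    (hsw : G.Adj s w) : PathCoverable G (insert s (D ∪ E)) := by
  obtain ⟨b, hb, hbD, hbc⟩ := hD
  obtain ⟨c, hc, hcE, hcc⟩ := hE
  have hd := Finset.disjoint_left.1 hDE
  have h1 : IsPathList G (s :: w :: c) := hc.cons hsw fun h => hsE (hcE _ h)
  have h2 := hb.join h1 hsv.symm (by simp; grind)
  refine (hbc.union hcc (Finset.disjoint_of_subset_left Finset.sdiff_subset
    (Finset.disjoint_of_subset_right Finset.sdiff_subset hDE))).of_path h2 (by simp; omega) ?_ ?_
  · intro z; simp; grind
  · intro z; simp; grind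

lemma HangsAt.cons {D : Finset V} {s v : V} (hD : HangsAt G D v) (hs : s ∉ D)
    (hsv : G.Adj s v) : HangsAt G (insert s D) s := by
  obtain ⟨b, hb, hbD, hbc⟩ := hD
  refine ⟨v :: b, hb.cons hsv fun h => hs (hbD _ h), by simp; grind, ?_⟩
  convert hbc using 1
  ext z; simp; grind

lemma HangsAt.union {D B : Finset V} {v : V} (hD : HangsAt G D v) (hB : PathCoverable G B)
    (hd : Disjoint D B) : HangsAt G (D ∪ B) v := by
  obtain ⟨b, hb, hbD, hbc⟩ := hD
  have hd' := Finset.disjoint_left.1 hd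
  refine ⟨b, hb, fun z hz => Finset.mem_union_left _ (hbD z hz), ?_⟩
  convert hbc.union hB (Finset.disjoint_of_subset_left Finset.sdiff_subset hd) using 1
  ext z; simp; grind

/-- Hall's theorem for the assignment of sun components to the slots `T` of vertices of `S`. -/
lemma exists_assignment {S : Finset V} {T : Finset (V × Bool)} {𝒟 : Finset (Finset V)}
    (hT : ∀ t ∈ T, t.1 ∈ S)
    (hH : ∀ Y ⊆ S, ∀ 𝒩 ⊆ 𝒟, (∀ D ∈ 𝒟, (∃ s ∈ Y, ∃ v ∈ D, G.Adj s v) → D ∈ 𝒩) →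
      (T.filter fun t => t.1 ∈ Y).card ≤ 𝒩.card) :
    ∃ f : V × Bool → Finset V, (∀ t ∈ T, f t ∈ 𝒟 ∧ ∃ v ∈ f t, G.Adj t.1 v) ∧
      ∀ t ∈ T, ∀ t' ∈ T, f t = f t' → t = t' := by
  classical
  let g : T → Finset (Finset V) := fun t => 𝒟.filter fun D => ∃ v ∈ D, G.Adj t.1.1 v
  have key : ∀ s : Finset T, s.card ≤ (s.biUnion g).card := by
    intro s
    let Y : Finset V := s.image fun t => t.1.1
    have h1 : (s.map (Function.Embedding.subtype _)) ⊆ T.filter fun t => t.1 ∈ Y := by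
      intro t ht
      simp only [Finset.mem_map, Function.Embedding.subtype_apply] at ht
      obtain ⟨a, ha, rfl⟩ := ht
      exact Finset.mem_filter.2 ⟨a.2, Finset.mem_image_of_mem _ ha⟩
    have h2 := Finset.card_le_card h1
    rw [Finset.card_map] at h2
    refine h2.trans (hH Y ?_ _ ?_ ?_)
    · intro y hy
      obtain ⟨t, ht, rfl⟩ := Finset.mem_image.1 hy
      exact hT _ t.2
    · intro D hD
      obtain ⟨t, -, ht⟩ := Finset.mem_biUnion.1 hD
      exact (Finset.mem_filter.1 ht).1
    · rintro D hD ⟨y, hy, v, hv, ha⟩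
      obtain ⟨t, ht, rfl⟩ := Finset.mem_image.1 hy
      exact Finset.mem_biUnion.2 ⟨t, ht, Finset.mem_filter.2 ⟨hD, v, hv, ha⟩⟩
  obtain ⟨f, hf, hfg⟩ := (Finset.all_card_le_biUnion_card_iff_exists_injective g).1 key
  refine ⟨fun t => if ht : t ∈ T then f ⟨t, ht⟩ else ∅, ?_, ?_⟩
  · intro t ht
    have := hfg ⟨t, ht⟩
    simp only [ht, dif_pos]
    exact Finset.mem_filter.1 this
  · intro t ht t' ht' he
    simp only [ht, ht', dif_pos] at he
    exact congrArg Subtype.val (hf he)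

/-- Vertices each of which is assigned two suns of its own are covered with them. -/
lemma pathCoverable_of_assignment {A S S' : Finset V} {f : V × Bool → Finset V} (hS : S' ⊆ S)
    (hf : ∀ s ∈ S', ∀ b, f (s, b) ∈ suns G (A \ S) ∧ ∃ v ∈ f (s, b), G.Adj s v)
    (hinj : ∀ s ∈ S', ∀ b, ∀ s' ∈ S', ∀ b', f (s, b) = f (s', b') → (s, b) = (s', b')) :
    PathCoverable G (S'.biUnion fun s => insert s (f (s, true) ∪ f (s, false))) := by
  have hnot : ∀ s ∈ S', ∀ b, ∀ s' ∈ S', s ∉ f (s', b) := by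
    intro s hs b s' hs' h
    exact (Finset.mem_sdiff.1 ((mem_suns.1 (hf s' hs' b).1).1 h)).2 (hS hs)
  have hdis : ∀ s ∈ S', ∀ b, ∀ s' ∈ S', ∀ b', (s, b) ≠ (s', b') →
      Disjoint (f (s, b)) (f (s', b')) := fun s hs b s' hs' b' hne =>
    suns_disjoint (hf s hs b).1 (hf s' hs' b').1 fun h => hne (hinj s hs b s' hs' b' h)
  refine PathCoverable.biUnion _ _ ?_ ?_
  · intro s hs
    obtain ⟨h1, v, hv, hsv⟩ := hf s hs true
    obtain ⟨h2, w, hw, hsw⟩ := hf s hs false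
    exact ((mem_suns.1 h1).2.1.hangsAt hv).pathCoverable_insert ((mem_suns.1 h2).2.1.hangsAt hw)
      (hdis s hs _ s hs _ (by simp)) (hnot s hs _ s hs) (hnot s hs _ s hs) hsv hsw
  · intro s hs s' hs' hne
    have d1 : ∀ b b', Disjoint (f (s, b)) (f (s', b')) := fun b b' =>
      hdis s hs b s' hs' b' (by simp [hne])
    simp only [Finset.disjoint_insert_left, Finset.disjoint_insert_right,
      Finset.disjoint_union_left, Finset.disjoint_union_right, Finset.mem_insert,
      Finset.mem_union, d1, hnot s hs _ s' hs', hnot s' hs' _ s hs]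
    simp [hne.symm]

/-- Because `N` is closed and misses the suns of `𝒟`, the suns of `N \ X` and those of `𝒟` are
distinct suns of `A \ (S ∪ X)`. Subtracting `|𝒟|` from the bound for `S ∪ X` gives the sun condition
on `N`. -/
lemma card_suns_rest {A S N X : Finset V} {𝒟 : Finset (Finset V)} (hN : N ⊆ A \ S)
    (hcl : ClosedIn G (A \ S) N) (h𝒟 : 𝒟 ⊆ suns G (A \ S)) (hdis : ∀ D ∈ 𝒟, Disjoint D N)
    (hX : X ⊆ N) : (suns G (N \ X)).card + 𝒟.card ≤ (suns G (A \ (S ∪ X))).card := by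
  have hd : Disjoint (suns G (N \ X)) 𝒟 := by
    rw [Finset.disjoint_left]
    intro D hD hD'
    obtain ⟨z, hz⟩ := (mem_suns.1 hD).2.1.nonempty
    exact Finset.disjoint_left.1 (hdis D hD') hz
      (Finset.mem_sdiff.1 ((mem_suns.1 hD).1 hz)).1
  rw [← Finset.card_union_of_disjoint hd]
  refine Finset.card_le_card fun D hD => ?_
  rcases Finset.mem_union.1 hD with h | h
  · obtain ⟨h1, h2, h3⟩ := mem_suns.1 h
    refine mem_suns.2 ⟨fun z hz => ?_, h2, fun u hu w hw ha => ?_⟩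
    · have := h1 hz
      have := hN (Finset.mem_sdiff.1 this).1
      grind
    · have hu' := (Finset.mem_sdiff.1 (h1 hu)).1
      have := hcl u hu' w (by grind) ha
      exact h3 u hu w (by grind) ha
  · obtain ⟨h1, h2, h3⟩ := mem_suns.1 (h𝒟 h)
    refine mem_suns.2 ⟨fun z hz => ?_, h2, fun u hu w hw ha => ?_⟩
    · have := h1 hz
      have := Finset.disjoint_left.1 (hdis D h) hz
      grind
    · exact h3 u hu w (by grind) ha

/-- A sun without neighbours in `Y` remains a sun component when `Y` is put back. Combined with a
sun bound for `S \ Y`, this is Hall's inequality. -/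
lemma card_suns_not_adj {A S Y : Finset V} {𝒟 𝒩 : Finset (Finset V)}
    (h𝒟 : 𝒟 ⊆ suns G (A \ S))
    (h𝒩 : ∀ D ∈ 𝒟, (∃ s ∈ Y, ∃ v ∈ D, G.Adj s v) → D ∈ 𝒩) :
    (𝒟 \ 𝒩).card ≤ (suns G (A \ (S \ Y))).card := by
  refine Finset.card_le_card fun D hD => ?_
  obtain ⟨hD1, hD2⟩ := Finset.mem_sdiff.1 hD
  obtain ⟨h1, h2, h3⟩ := mem_suns.1 (h𝒟 hD1)
  refine mem_suns.2 ⟨fun z hz => ?_, h2, fun u hu w hw ha => ?_⟩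
  · have := h1 hz
    grind
  · by_cases hwY : w ∈ Y
    · exact (hD2 (h𝒩 D hD1 ⟨w, hwY, u, hu, ha.symm⟩)).elim
    · exact h3 u hu w (by grind) ha

lemma closedIn_rest {A B : Finset V} {𝒟 : Finset (Finset V)} (hB : ClosedIn G A B)
    (h𝒟 : 𝒟 ⊆ suns G A) : ClosedIn G A ((A \ 𝒟.biUnion id) \ B) := by
  intro u hu w hw ha
  simp only [Finset.mem_sdiff, Finset.mem_biUnion, id, not_exists, not_and] at hu ⊢
  refine ⟨⟨hw, fun D hD hwD => hu.1.2 D hD ?_⟩, fun hwB => hu.2 (hB w hwB u hu.1.1 ha.symm)⟩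
  exact (mem_suns.1 (h𝒟 hD)).2.2 w hwD u hu.1.1 ha.symm

/-- If a nonempty set attains equality in the sun condition, the graph is path coverable, provided
that smaller sets satisfying the condition are. -/
lemma pathCoverable_of_tight {A S : Finset V}
    (ih : ∀ B : Finset V, B.card < A.card → SunCondition G B → PathCoverable G B)
    (hA : SunCondition G A) (hS : S ⊆ A) (hne : S.Nonempty)
    (hcard : (suns G (A \ S)).card = 2 * S.card) : PathCoverable G A := by
  set 𝒟 := suns G (A \ S) with h𝒟
  obtain ⟨f, hf, hinj⟩ := exists_assignment (G := G) (S := S) (T := S ×ˢ Finset.univ) (𝒟 := 𝒟)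
    (by simp) (by
      intro Y hY 𝒩 h𝒩 hN
      have h1 : ((S ×ˢ (Finset.univ : Finset Bool)).filter fun t => t.1 ∈ Y) =
          Y ×ˢ Finset.univ := by
        ext ⟨a, b⟩; simp; exact fun h => hY h
      rw [h1, Finset.card_product]
      -- At most `2|S \ Y|` suns lie outside `𝒩`, so at least `2|Y|` of the `2|S|` suns lie in it.
      have h2 := card_suns_not_adj (Finset.Subset.refl _) hN
      have h3 := hA (S \ Y) (Finset.sdiff_subset.trans hS)
      rw [Finset.card_sdiff_of_subset h𝒩] at h2
      rw [Finset.card_sdiff_of_subset hY] at h3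
      have := Finset.card_le_card hY
      have := Finset.card_le_card h𝒩
      simp
      omega)
  -- There are as many slots as suns, so the assignment is onto and no sun of `𝒟` is left over.
  have himg : (S ×ˢ (Finset.univ : Finset Bool)).image f = 𝒟 := by
    refine Finset.eq_of_subset_of_card_le ?_ ?_
    · intro D hD
      obtain ⟨t, ht, rfl⟩ := Finset.mem_image.1 hD
      exact (hf t ht).1
    · rw [Finset.card_image_of_injOn (fun t ht t' ht' h => hinj t ht t' ht' h), hcard]
      simp [Finset.card_product, mul_comm]
  have hmem : ∀ D, D ∈ 𝒟 ↔ ∃ s ∈ S, ∃ b, f (s, b) = D := by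
    intro D; rw [← himg]; simp
  -- Removing `∅` only brings `N` into the form of `closedIn_rest`.
  set N := ((A \ S) \ 𝒟.biUnion id) \ ∅ with hN
  have hNsub : N ⊆ A \ S := by grind
  have hcov : PathCoverable G N := by
    refine ih N ?_ fun X hX => ?_
    · obtain ⟨s, hs⟩ := hne
      exact Finset.card_lt_card ⟨hNsub.trans Finset.sdiff_subset, fun h =>
        (Finset.mem_sdiff.1 (hNsub (h (hS hs)))).2 hs⟩
    · have h1 := card_suns_rest hNsub (closedIn_rest (by simp [ClosedIn]) h𝒟.subset) h𝒟.subset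
        (fun D hD => by
          rw [Finset.disjoint_left]; intro z hz hzN
          simp only [hN, Finset.mem_sdiff, Finset.mem_biUnion, id] at hzN
          exact hzN.1.2 ⟨D, hD, hz⟩) hX
      have h2 := hA (S ∪ X) (Finset.union_subset hS
        (hX.trans (hNsub.trans Finset.sdiff_subset)))
      have h3 := Finset.card_union_le S X
      omega
  have hcov2 := pathCoverable_of_assignment (G := G) (A := A) (S := S) (S' := S) (f := f)
    (Finset.Subset.refl _) (fun s hs b => hf (s, b) (by simp [hs]))
    (fun s hs b s' hs' b' => hinj (s, b) (by simp [hs]) (s', b') (by simp [hs']))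
  have hsub : ∀ s ∈ S, ∀ b, f (s, b) ⊆ A \ S := fun s hs b =>
    (mem_suns.1 (hf (s, b) (by simp [hs])).1).1
  convert hcov.union hcov2 ?_ using 1
  · ext z
    simp only [hN, Finset.mem_union, Finset.mem_sdiff, Finset.mem_biUnion, id, hmem,
      Finset.mem_insert]
    constructor
    · intro hz
      by_cases hzS : z ∈ S
      · exact .inr ⟨z, hzS, .inl rfl⟩
      by_cases h : ∃ D, (∃ s ∈ S, ∃ b, f (s, b) = D) ∧ z ∈ D
      · obtain ⟨D, ⟨s, hs, b, rfl⟩, hzD⟩ := h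
        refine .inr ⟨s, hs, .inr ?_⟩
        cases b
        · exact .inr hzD
        · exact .inl hzD
      · exact .inl ⟨⟨⟨hz, hzS⟩, h⟩, by simp⟩
    · rintro (h | ⟨s, hs, rfl | h | h⟩)
      · exact h.1.1.1
      · exact hS hs
      · exact (Finset.mem_sdiff.1 (hsub s hs _ h)).1
      · exact (Finset.mem_sdiff.1 (hsub s hs _ h)).1
  · rw [Finset.disjoint_left]
    intro z hz hz'
    simp only [hN, Finset.mem_sdiff, Finset.mem_biUnion, id, hmem, Finset.mem_insert,
      Finset.mem_union] at hz hz'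
    obtain ⟨s, hs, rfl | h | h⟩ := hz'
    · exact hz.1.1.2 hs
    · exact hz.1.2 ⟨_, ⟨s, hs, _, rfl⟩, h⟩
    · exact hz.1.2 ⟨_, ⟨s, hs, _, rfl⟩, h⟩

/-! ### The strict condition and coverings of coronas -/

/-- The strict form of the sun condition for nonempty sets. -/
def StrictSunCondition (G : SimpleGraph V) (A : Finset V) : Prop :=
  ∀ S ⊆ A, S.Nonempty → (suns G (A \ S)).card + 1 ≤ 2 * S.card

/-- Under the strict condition, all but a closed part `B` is covered except for a path starting at
a prescribed vertex of `S`. -/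
lemma hangsAt_of_strict {A S B : Finset V} {𝒟 : Finset (Finset V)} {s₀ : V}
    (ih : ∀ B : Finset V, B.card < A.card → SunCondition G B → PathCoverable G B)
    (hA : SunCondition G A) (hA' : StrictSunCondition G A) (hS : S ⊆ A) (hs₀ : s₀ ∈ S)
    (hBA : B ⊆ A \ S) (hB : ClosedIn G (A \ S) B) (h𝒟 : 𝒟 ⊆ suns G (A \ S))
    (hdis : ∀ D ∈ 𝒟, Disjoint D B) (hcard : 𝒟.card + 1 = 2 * S.card) :
    HangsAt G (A \ B) s₀ := by
  -- The vertex `s₀` receives one sun only, so it is the end of a path that can be continued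
  -- elsewhere.
  set T : Finset (V × Bool) := (S ×ˢ Finset.univ).erase (s₀, false) with hT
  have hTcard : T.card = 𝒟.card := by
    rw [hT, Finset.card_erase_of_mem (by simp [hs₀]), Finset.card_product]
    simp; omega
  obtain ⟨f, hf, hinj⟩ := exists_assignment (G := G) (S := S) (T := T) (𝒟 := 𝒟)
    (by simp [hT]) (by
      intro Y hY 𝒩 h𝒩 hN
      have h2 := card_suns_not_adj h𝒟 hN
      rw [Finset.card_sdiff_of_subset h𝒩] at h2
      have := Finset.card_le_card hY
      have := Finset.card_le_card h𝒩
      -- If `s₀ ∈ Y`, one slot fewer is needed and the weak condition suffices. If not, `S \ Y` is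
      -- nonempty and strictness supplies the missing unit.
      by_cases hY0 : s₀ ∈ Y
      · have h1 : (T.filter fun t => t.1 ∈ Y) = (Y ×ˢ Finset.univ).erase (s₀, false) := by
          ext ⟨a, b⟩
          simp only [hT, Finset.mem_filter, Finset.mem_erase, Finset.mem_product,
            Finset.mem_univ, and_true]
          exact ⟨fun h => ⟨h.1.1, h.2⟩, fun h => ⟨⟨h.1, hY h.2⟩, h.2⟩⟩
        rw [h1, Finset.card_erase_of_mem (by simp [hY0]), Finset.card_product]
        have h3 := hA (S \ Y) (Finset.sdiff_subset.trans hS)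
        rw [Finset.card_sdiff_of_subset hY] at h3
        simp
        omega
      · have h1 : (T.filter fun t => t.1 ∈ Y) = Y ×ˢ Finset.univ := by
          ext ⟨a, b⟩
          simp only [hT, Finset.mem_filter, Finset.mem_erase, Finset.mem_product,
            Finset.mem_univ, and_true]
          refine ⟨fun h => h.2, fun h => ⟨⟨?_, hY h⟩, h⟩⟩
          rintro ⟨⟩
          exact hY0 h
        rw [h1, Finset.card_product]
        have h3 := hA' (S \ Y) (Finset.sdiff_subset.trans hS)
          ⟨s₀, Finset.mem_sdiff.2 ⟨hs₀, hY0⟩⟩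
        rw [Finset.card_sdiff_of_subset hY] at h3
        simp
        omega)
  have himg : T.image f = 𝒟 := by
    refine Finset.eq_of_subset_of_card_le ?_ ?_
    · intro D hD
      obtain ⟨t, ht, rfl⟩ := Finset.mem_image.1 hD
      exact (hf t ht).1
    · rw [Finset.card_image_of_injOn (fun t ht t' ht' h => hinj t ht t' ht' h), hTcard]
  have hmem : ∀ D, D ∈ 𝒟 ↔ D = f (s₀, true) ∨ ∃ s ∈ S.erase s₀, ∃ b, f (s, b) = D := by
    intro D
    rw [← himg]
    simp only [hT, Finset.mem_image, Finset.mem_erase, Finset.mem_product, Finset.mem_univ,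
      and_true, Prod.exists]
    constructor
    · rintro ⟨s, b, ⟨h1, h2⟩, rfl⟩
      by_cases h : s = s₀
      · subst h
        cases b
        · exact (h1 rfl).elim
        · exact .inl rfl
      · exact .inr ⟨s, ⟨h, h2⟩, b, rfl⟩
    · rintro (rfl | ⟨s, ⟨h1, h2⟩, b, rfl⟩)
      · exact ⟨s₀, true, ⟨by simp, hs₀⟩, rfl⟩
      · exact ⟨s, b, ⟨by simp [h1], h2⟩, rfl⟩
  set N := ((A \ S) \ 𝒟.biUnion id) \ B with hN
  have hNsub : N ⊆ A \ S := by grind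
  have hNmem : ∀ z, z ∈ N ↔ z ∈ A ∧ z ∉ S ∧ (∀ D ∈ 𝒟, z ∉ D) ∧ z ∉ B := by
    intro z
    simp only [hN, Finset.mem_sdiff, Finset.mem_biUnion, id, not_exists, not_and, and_assoc]
  have hcov : PathCoverable G N := by
    refine ih N ?_ fun X hX => ?_
    · exact Finset.card_lt_card ⟨hNsub.trans Finset.sdiff_subset, fun h =>
        (Finset.mem_sdiff.1 (hNsub (h (hS hs₀)))).2 hs₀⟩
    · have h1 := card_suns_rest hNsub (closedIn_rest hB h𝒟) h𝒟
        (fun D hD => by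
          rw [Finset.disjoint_left]; intro z hz hzN
          exact ((hNmem z).1 hzN).2.2.1 D hD hz) hX
      -- Strictness makes up for `𝒟` having only `2|S| - 1` members.
      have h2 := hA' (S ∪ X) (Finset.union_subset hS
        (hX.trans (hNsub.trans Finset.sdiff_subset))) ⟨s₀, Finset.mem_union_left _ hs₀⟩
      have h3 := Finset.card_union_le S X
      omega
  have hT1 : ∀ s ∈ S.erase s₀, ∀ b, (s, b) ∈ T := by
    intro s hs b
    rw [Finset.mem_erase] at hs
    simp [hT, hs.1, hs.2]
  have hT0 : (s₀, true) ∈ T := by simp [hT, hs₀]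
  have hcov2 := pathCoverable_of_assignment (G := G) (A := A) (S := S) (S' := S.erase s₀) (f := f)
    (Finset.erase_subset _ _) (fun s hs b => ⟨h𝒟 (hf _ (hT1 s hs b)).1, (hf _ (hT1 s hs b)).2⟩)
    (fun s hs b s' hs' b' => hinj _ (hT1 s hs b) _ (hT1 s' hs' b'))
  have hsub : ∀ t ∈ T, ∀ z ∈ f t, z ∈ A ∧ z ∉ S := fun t ht z hz =>
    Finset.mem_sdiff.1 ((mem_suns.1 (h𝒟 (hf t ht).1)).1 hz)
  obtain ⟨hm0, v, hv, hsv⟩ := hf _ hT0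
  have hhang := ((mem_suns.1 (h𝒟 hm0)).2.1.hangsAt hv).cons
    (s := s₀) (fun h => (hsub _ hT0 _ h).2 hs₀) hsv
  have hdisj : ∀ s ∈ S.erase s₀, ∀ b, ∀ z ∈ f (s, b), z ∉ f (s₀, true) := by
    intro s hs b z hz hz'
    have h1 := suns_eq_of_mem (h𝒟 (hf _ (hT1 s hs b)).1) (h𝒟 hm0) hz hz'
    have h2 := hinj _ (hT1 s hs b) _ hT0 h1
    simp only [Prod.mk.injEq] at h2
    exact (Finset.mem_erase.1 hs).1 h2.1
  have hrest := hcov.union hcov2 (by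
    rw [Finset.disjoint_left]
    intro z hz hz'
    rw [hNmem] at hz
    simp only [Finset.mem_biUnion, Finset.mem_insert, Finset.mem_union] at hz'
    obtain ⟨s, hs, rfl | h | h⟩ := hz'
    · exact hz.2.1 (Finset.mem_of_mem_erase hs)
    · exact hz.2.2.1 _ (hf _ (hT1 s hs _)).1 h
    · exact hz.2.2.1 _ (hf _ (hT1 s hs _)).1 h)
  convert hhang.union hrest ?_ using 1
  · ext z
    simp only [Finset.mem_union, Finset.mem_sdiff, Finset.mem_biUnion, Finset.mem_insert]
    constructor
    · rintro ⟨hz, hzB⟩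
      by_cases hz0 : z = s₀
      · exact .inl (.inl hz0)
      by_cases hzS : z ∈ S
      · exact .inr (.inr ⟨z, Finset.mem_erase.2 ⟨hz0, hzS⟩, .inl rfl⟩)
      by_cases h : ∃ D ∈ 𝒟, z ∈ D
      · obtain ⟨D, hD, hzD⟩ := h
        rcases (hmem D).1 hD with rfl | ⟨s, hs, b, rfl⟩
        · exact .inl (.inr hzD)
        refine .inr (.inr ⟨s, hs, .inr ?_⟩)
        cases b
        · exact .inr hzD
        · exact .inl hzD
      · push Not at h
        exact .inr (.inl ((hNmem z).2 ⟨hz, hzS, h, hzB⟩))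
    · have hB' : ∀ z ∈ S, z ∉ B := fun z hz hzB => (Finset.mem_sdiff.1 (hBA hzB)).2 hz
      have hd' : ∀ t ∈ T, ∀ z ∈ f t, z ∉ B := fun t ht z hz =>
        Finset.disjoint_left.1 (hdis _ (hf t ht).1) hz
      rintro ((rfl | h) | (h | ⟨s, hs, rfl | h | h⟩))
      · exact ⟨hS hs₀, hB' _ hs₀⟩
      · exact ⟨(hsub _ hT0 _ h).1, hd' _ hT0 _ h⟩
      · rw [hNmem] at h; exact ⟨h.1, h.2.2.2⟩
      · have := Finset.mem_of_mem_erase hs; exact ⟨hS this, hB' _ this⟩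
      · exact ⟨(hsub _ (hT1 s hs _) _ h).1, hd' _ (hT1 s hs _) _ h⟩
      · exact ⟨(hsub _ (hT1 s hs _) _ h).1, hd' _ (hT1 s hs _) _ h⟩
  · rw [Finset.disjoint_left]
    intro z hz hz'
    simp only [Finset.mem_union, Finset.mem_biUnion, Finset.mem_insert] at hz hz'
    rcases hz' with h | ⟨s, hs, rfl | h⟩
    · rw [hNmem] at h
      rcases hz with rfl | hz
      · exact h.2.1 hs₀
      · exact h.2.2.1 _ hm0 hz
    · rcases hz with rfl | hz
      · exact Finset.notMem_erase _ _ hs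
      · exact (hsub _ hT0 _ hz).2 (Finset.mem_of_mem_erase hs)
    · rcases hz with rfl | hz
      · rcases h with h | h
        · exact (hsub _ (hT1 s hs _) _ h).2 hs₀
        · exact (hsub _ (hT1 s hs _) _ h).2 hs₀
      · rcases h with h | h
        · exact hdisj s hs _ z h hz
        · exact hdisj s hs _ z h hz

/-- This forces a leaf onto the same covering path as its only neighbour. -/
lemma PathCoverable.exists_adj {B : Finset V} (h : PathCoverable G B) {z : V} (hz : z ∈ B) :
    ∃ w ∈ B, G.Adj z w := by
  induction h with
  | empty => simp at hz
  | @cons l B hl h3 hd _ ih =>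
    rcases Finset.mem_union.1 hz with h | h
    · obtain ⟨i, hi, rfl⟩ := List.getElem_of_mem (List.mem_toFinset.1 h)
      have hc := List.isChain_iff_getElem.1 hl.1
      by_cases hlast : i + 1 < l.length
      · exact ⟨l[i + 1], by simp, hc i hlast⟩
      · obtain ⟨j, rfl⟩ : ∃ j, i = j + 1 := ⟨i - 1, by omega⟩
        exact ⟨l[j], by simp, (hc j hi).symm⟩
    · obtain ⟨w, hw, ha⟩ := ih h
      exact ⟨w, Finset.mem_union_right _ hw, ha⟩

/-- A path covering of a corona induces a perfect matching of its base. -/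
lemma PathCoverable.perfectlyMatched {B M : Finset V} {σ : V → V} (h : PathCoverable G B)
    (hB : ∀ z, z ∈ B ↔ z ∈ M ∨ ∃ r ∈ M, σ r = z)
    (hinj : ∀ r ∈ M, ∀ s ∈ M, σ r = σ s → r = s) (hnot : ∀ r ∈ M, σ r ∉ M)
    (hleaf : ∀ r ∈ M, ∀ w ∈ B, G.Adj (σ r) w → w = r) : PerfectlyMatched G M := by
  induction h generalizing M with
  | empty =>
    have : M = ∅ := Finset.eq_empty_of_forall_notMem fun z hz => by
      simpa using (hB z).2 (.inl hz)
    rw [this]; exact .empty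
  | @cons l B hl h3 hd hcov ih =>
    have hd' : ∀ z ∈ l, z ∉ B := fun z hz => Finset.disjoint_left.1 hd (List.mem_toFinset.2 hz)
    have hlB : ∀ i (hi : i < l.length), l[i] ∈ l.toFinset ∪ B := fun i hi => by simp
    have hc := List.isChain_iff_getElem.1 hl.1
    have hnd : ∀ i j (hi : i < l.length) (hj : j < l.length), l[i] = l[j] → i = j :=
      fun i j hi hj h => (hl.2.getElem_inj_iff).1 h
    have hleafmem : ∀ r ∈ M, r ∈ l → ∃ k, ∃ hk : k < l.length, l[k] = σ r := by
      intro r hr hrl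
      have h1 : σ r ∈ l.toFinset ∪ B := (hB _).2 (.inr ⟨r, hr, rfl⟩)
      rcases Finset.mem_union.1 h1 with h | h
      · exact List.getElem_of_mem (List.mem_toFinset.1 h)
      · obtain ⟨w, hw, ha⟩ := hcov.exists_adj h
        have := hleaf r hr w (Finset.mem_union_right _ hw) ha
        subst this
        exact (hd' _ hrl hw).elim
    -- A leaf has one neighbour only, so it is an end of `l`, with its base vertex next to it.
    have hpos : ∀ r ∈ M, ∀ k, ∀ hk : k < l.length, l[k] = σ r → ∀ j, ∀ hj : j < l.length,
        l[j] = r → (k = 0 ∧ j = 1) ∨ (k + 1 = l.length ∧ j + 1 = k) := by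
      intro r hr k hk hkr j hj hjr
      by_cases hlast : k + 1 < l.length
      · have h1 := hleaf r hr _ (hlB (k + 1) hlast) (hkr ▸ hc k hlast)
        have h2 := hnd _ _ hlast hj (h1.trans hjr.symm)
        by_cases h0 : k = 0
        · exact .inl ⟨h0, by omega⟩
        obtain ⟨i, rfl⟩ : ∃ i, k = i + 1 := ⟨k - 1, by omega⟩
        have h3 := hleaf r hr _ (hlB i (by omega)) (hkr ▸ (hc i hk).symm)
        have h4 := hnd _ _ _ hj (h3.trans hjr.symm)
        omega
      · obtain ⟨i, rfl⟩ : ∃ i, k = i + 1 := ⟨k - 1, by omega⟩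
        have h3 := hleaf r hr _ (hlB i (by omega)) (hkr ▸ (hc i hk).symm)
        have h4 := hnd _ _ _ hj (h3.trans hjr.symm)
        exact .inr ⟨by omega, by omega⟩
    have hbase : ∀ i, ∀ hi : i < l.length, l[i] ∈ M ∨ ∃ r ∈ M, σ r = l[i] :=
      fun i hi => (hB _).1 (hlB i hi)
    -- An inner vertex of a path has two neighbours and so is no leaf.
    have hbase_int : ∀ i, ∀ hi : i + 2 < l.length, l[i + 1] ∈ M := by
      intro i hi
      rcases hbase (i + 1) (by omega) with h | ⟨r, hr, h⟩
      · exact h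
      · have h1 := hleaf r hr _ (hlB i (by omega)) (h ▸ (hc i (by omega)).symm)
        have h2 := hleaf r hr _ (hlB (i + 2) (by omega)) (h ▸ (hc (i + 1) (by omega)))
        have := hnd _ _ _ _ (h1.trans h2.symm)
        omega
    have hb := hbase_int 0 (by omega)
    simp only [zero_add] at hb
    obtain ⟨k, hk, hkb⟩ := hleafmem _ hb (by simp)
    have hk' := hpos _ hb k hk hkb 1 (by omega) rfl
    -- Otherwise `l` has order three and ends in the leaf of `l[1]`. Then `l[0]` cannot be a base
    -- vertex, whose leaf would have to be `l[1]`, nor a leaf, which would have to be that of `l[1]`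
    -- again.
    have hk0 : k = 0 := by
      rcases hk' with h | h
      · exact h.1
      · exfalso
        obtain rfl : k = 2 := by omega
        rcases hbase 0 (by omega) with h0 | ⟨r, hr, h0⟩
        · obtain ⟨k', hk', hkb'⟩ := hleafmem _ h0 (by simp)
          have := hpos _ h0 k' hk' hkb' 0 (by omega) rfl
          obtain rfl : k' = 1 := by omega
          exact hnot _ h0 (hkb' ▸ hb)
        · have h1 := hleaf r hr _ (hlB 1 (by omega)) (h0 ▸ hc 0 (by omega))
          subst h1
          have := hnd _ _ hk _ (hkb.trans h0)
          omega
    subst hk0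
    have hcM : l[2] ∈ M := by
      rcases hbase 2 (by omega) with h0 | ⟨r, hr, h0⟩
      · exact h0
      · have h1 := hleaf r hr _ (hlB 1 (by omega)) (h0 ▸ (hc 1 (by omega)).symm)
        subst h1
        have := hnd _ _ _ _ (hkb.trans h0)
        omega
    obtain ⟨k, hk, hkc⟩ := hleafmem _ hcM (by simp)
    have hk3 : k = 3 ∧ l.length = 4 := by
      have := hpos _ hcM k hk hkc 2 (by omega) rfl
      omega
    obtain ⟨rfl, hlen⟩ := hk3
    -- The path is a base edge with its two leaves; this edge enters the matching.
    have hlist : l = [σ l[1], l[1], l[2], σ l[2]] := by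
      conv_lhs => rw [show l = [l[0], l[1], l[2], l[3]] from List.ext_getElem (by simp [hlen])
        (by
          intro i h1 h2
          have : i < 4 := by omega
          interval_cases i <;> simp)]
      rw [hkb, hkc]
    have hbc := hc 1 (by omega)
    simp only [Nat.reduceAdd] at hbc
    generalize l[1] = b at *
    generalize l[2] = c at *
    clear hpos hnd hc hbase hbase_int hleafmem hlB hcov hkb hkc
    have hM : M = insert b (insert c ((M.erase b).erase c)) := by
      ext z; simp; grind
    have hsub : ∀ r ∈ (M.erase b).erase c, r ∈ M := fun r hr =>
      Finset.mem_of_mem_erase (Finset.mem_of_mem_erase hr)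
    rw [hM]
    refine .cons hbc (by simp) (by simp) (ih ?_ ?_ ?_ ?_)
    · intro z
      have h1 : z ∈ B ↔ z ∉ l ∧ (z ∈ M ∨ ∃ r ∈ M, σ r = z) := by
        rw [← hB]; simp; grind
      rw [h1, hlist]
      have h2 := hinj b hb
      have h3 := hinj c hcM
      have h4 := hnot b hb
      have h5 := hnot c hcM
      clear h1 hB hleaf hlist hd hd' ih hM
      simp only [List.mem_cons, List.not_mem_nil, or_false, Finset.mem_erase]
      grind
    · exact fun r hr s hs => hinj r (hsub r hr) s (hsub s hs)
    · exact fun r hr h => hnot r (hsub r hr) (hsub _ h)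
    · exact fun r hr w hw => hleaf r (hsub r hr) w (Finset.mem_union_right _ hw)

/-! ### Deleting an edge under the strict condition -/

/-- `x` has at least two neighbours in `A`. -/
def HasTwoNeighbors (G : SimpleGraph V) (A : Finset V) (x : V) : Prop :=
  ∀ u, ∃ w ∈ A, w ≠ u ∧ G.Adj x w

/-- `x` has a neighbour in `A` of degree one. -/
def HasPendant (G : SimpleGraph V) (A : Finset V) (x : V) : Prop :=
  ∃ p ∈ A, G.Adj p x ∧ ∀ w ∈ A, G.Adj p w → w = x

/-- Some sun component of `A \ {y}` is joined to `y` by the edge `xy` only. -/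
def Dangles (G : SimpleGraph V) (A : Finset V) (x y : V) : Prop :=
  ∃ D ∈ suns G (A \ {y}), x ∈ D ∧ ∀ z ∈ D, G.Adj z y → z = x

/-- Two suns of `A \ S` joined by the edge `xy` and by no other edge to the rest of `A \ S`, such
that everything else is covered but for a path starting at any given vertex of `S`. -/
structure EdgeSplit (G : SimpleGraph V) (A S D E : Finset V) (x y : V) : Prop where
  subset : S ⊆ A
  nonempty : S.Nonempty
  left_subset : D ⊆ A \ S
  right_subset : E ⊆ A \ S
  disjoint : Disjoint D E
  left_sun : IsSun G D
  right_sun : IsSun G E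
  left_mem : x ∈ D
  right_mem : y ∈ E
  adj : G.Adj x y
  left_out : ∀ u ∈ D, ∀ w ∈ A \ S, G.Adj u w → w ∈ D ∨ (u = x ∧ w = y)
  right_out : ∀ u ∈ E, ∀ w ∈ A \ S, G.Adj u w → w ∈ E ∨ (u = y ∧ w = x)
  hangsAt : ∀ s ∈ S, HangsAt G (A \ (D ∪ E)) s

namespace EdgeSplit

variable {A S D E : Finset V} {x y : V}

lemma symm (h : EdgeSplit G A S D E x y) : EdgeSplit G A S E D y x where
  subset := h.subset
  nonempty := h.nonempty
  left_subset := h.right_subset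
  right_subset := h.left_subset
  disjoint := h.disjoint.symm
  left_sun := h.right_sun
  right_sun := h.left_sun
  left_mem := h.right_mem
  right_mem := h.left_mem
  adj := h.adj.symm
  left_out := h.right_out
  right_out := h.left_out
  hangsAt s hs := by rw [Finset.union_comm]; exact h.hangsAt s hs

/-- Outside `D` everything is covered except a path of `E` starting at `y` and a path starting at
`s`, so it is enough to absorb these two into `D`. -/
lemma pathCoverable (h : EdgeSplit G A S D E x y) {s : V} (hs : s ∈ S)
    (H : ∀ p q, IsPathList G (y :: p) → IsPathList G (s :: q) → (∀ z ∈ y :: p, z ∉ D) →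
      (∀ z ∈ s :: q, z ∉ D) → (∀ z ∈ y :: p, z ∉ s :: q) →
      PathCoverable G (D ∪ (y :: p).toFinset ∪ (s :: q).toFinset)) : PathCoverable G A := by
  obtain ⟨p, hp, hpE, hpc⟩ := h.right_sun.hangsAt h.right_mem
  obtain ⟨q, hq, hqA, hqc⟩ := h.hangsAt s hs
  have hDE := Finset.disjoint_left.1 h.disjoint
  have hqA' : ∀ z ∈ s :: q, z ∈ A ∧ z ∉ D ∧ z ∉ E := fun z hz => by simpa using hqA z hz
  have hD : ∀ z ∈ D, z ∈ A := fun z hz => (Finset.mem_sdiff.1 (h.left_subset hz)).1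
  have hE : ∀ z ∈ E, z ∈ A := fun z hz => (Finset.mem_sdiff.1 (h.right_subset hz)).1
  have hc := H p q hp hq (fun z hz hzD => hDE hzD (hpE z hz)) (fun z hz => (hqA' z hz).2.1)
    fun z hz hz' => (hqA' z hz').2.2 (hpE z hz)
  have h2 := hc.union (hpc.union hqc ?_) ?_
  · convert h2 using 1
    ext z
    simp only [Finset.mem_union, Finset.mem_sdiff, List.mem_toFinset]
    grind
  · rw [Finset.disjoint_left]
    intro z
    simp only [Finset.mem_union, Finset.mem_sdiff, List.mem_toFinset]
    grind
  · rw [Finset.disjoint_left]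
    intro z
    simp only [Finset.mem_union, Finset.mem_sdiff, List.mem_toFinset]
    grind

/-- The leaf at `x` cannot see `S`: a path hanging there and the path through `y` hanging at `x`
would both be absorbed. -/
lemma hasPendant_of_base (h : EdgeSplit G A S D E x y) (hcov : ¬ PathCoverable G A) {R : Finset V}
    {σ : V → V} (hc : IsCorona G D R σ) (hx : x ∈ R) :
    HasPendant G A x := by
  refine ⟨σ x, (Finset.mem_sdiff.1 (h.left_subset (hc.mem_leaf hx))).1, (hc.adj x hx).symm,
    fun w hw ha => ?_⟩
  by_cases hwS : w ∈ S
  · exact (hcov (h.pathCoverable hwS fun p q hp hq h1 h2 h3 =>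
      hc.pathCoverable_of_hang_base_leaf hx hx hp hq h1 h2 h3 h.adj ha)).elim
  · rcases h.left_out _ (hc.mem_leaf hx) w (Finset.mem_sdiff.2 ⟨hw, hwS⟩) ha with h1 | h1
    · exact hc.leaf x hx w h1 ha
    · exact (hc.ne_leaf hx hx h1.1.symm).elim

/-- A path through `y` hangs at `x`. When `x` is a leaf of a corona other than `K₂`, any edge from
`D` to `S` yields a second hanging path, hence a covering. When `D` is a single vertex, its second
neighbour lies in `S` and again gives a covering. -/
lemma pendant_or_dangling (h : EdgeSplit G A S D E x y) (hcov : ¬ PathCoverable G A)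
    (hx : HasTwoNeighbors G A x) :
    HasPendant G A x ∨ ∀ u ∈ D, ∀ w ∈ A, G.Adj u w → w ∈ D ∨ (u = x ∧ w = y) := by
  rcases h.left_sun.2 with ⟨v, rfl⟩ | ⟨R, σ, hc⟩
  · have hxv := Finset.mem_singleton.1 h.left_mem
    subst hxv
    obtain ⟨w, hw, hwy, ha⟩ := hx y
    by_cases hwS : w ∈ S
    · refine (hcov (h.pathCoverable hwS fun p q hp hq h1 h2 h3 => ?_)).elim
      have j1 := hp.cons h.adj fun hh => h1 _ hh (by simp)
      have j2 := hq.join j1 ha.symm (by simp; simp at h2; grind)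
      convert PathCoverable.single j2 (by simp; omega) using 1
      ext z; simp; grind
    · rcases h.left_out _ h.left_mem w (Finset.mem_sdiff.2 ⟨hw, hwS⟩) ha with h1 | h1
      · exact (ha.ne (Finset.mem_singleton.1 h1).symm).elim
      · exact (hwy h1.2).elim
  · rcases hc.base_or_leaf h.left_mem with ⟨R, σ, hc, hxR⟩ | ⟨R, σ, hc, r, hr, rfl, hR⟩
    · exact .inl (h.hasPendant_of_base hcov hc hxR)
    · refine .inr fun u hu w hw ha => ?_
      by_cases hwS : w ∈ S
      · exact (hcov (h.pathCoverable hwS fun p q hp hq h1 h2 h3 =>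
          hc.pathCoverable_of_hang_leaf hr hR hu hp hq h1 h2 h3 h.adj ha)).elim
      · exact h.left_out u hu w (Finset.mem_sdiff.2 ⟨hw, hwS⟩) ha

end EdgeSplit

lemma singleton_mem_suns {A : Finset V} {p y : V} (hp : p ∈ A) (ha : G.Adj p y)
    (h : ∀ w ∈ A, G.Adj p w → w = y) : {p} ∈ suns G (A \ {y}) := by
  refine mem_suns.2 ⟨by simp [hp, ha.ne], isSun_singleton p, ?_⟩
  intro u hu w hw huw
  rw [Finset.mem_singleton] at hu
  subst hu
  have := h w (Finset.mem_sdiff.1 hw).1 huw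
  simp [this] at hw

/-- For a one-element set the strict bound is `1`. -/
lemma StrictSunCondition.eq_of_mem {A D E : Finset V} {y : V} (h : StrictSunCondition G A)
    (hy : y ∈ A) (hD : D ∈ suns G (A \ {y})) (hE : E ∈ suns G (A \ {y})) : D = E := by
  have h1 := h {y} (by simpa using hy) (by simp)
  rw [Finset.card_singleton] at h1
  exact Finset.card_le_one.1 (by omega) D hD E hE

/-- Suppose `D` is attached to the rest by `xy` only. A pendant vertex at `y` would be a sun of `A \
{y}` other than `D`, against strictness. If instead `E` is also attached by `xy` only, then `D ∪ E`
is closed and misses `S`, against connectedness. -/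
lemma EdgeSplit.hasPendant {A S D E : Finset V} {x y : V} (h : EdgeSplit G A S D E x y)
    (hcov : ¬ PathCoverable G A) (hconn : ConnectedOn G A) (hA : StrictSunCondition G A)
    (hx : HasTwoNeighbors G A x) (hy : HasTwoNeighbors G A y) : HasPendant G A x := by
  rcases h.pendant_or_dangling hcov hx with h1 | h1
  · exact h1
  exfalso
  have hD : ∀ z ∈ D, z ∈ A ∧ z ∉ S := fun z hz => Finset.mem_sdiff.1 (h.left_subset hz)
  have hE : ∀ z ∈ E, z ∈ A ∧ z ∉ S := fun z hz => Finset.mem_sdiff.1 (h.right_subset hz)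
  have hyD : y ∉ D := fun hyD => Finset.disjoint_left.1 h.disjoint hyD h.right_mem
  rcases h.symm.pendant_or_dangling hcov hy with ⟨p, hp, hpy, hpA⟩ | h2
  · have m1 := singleton_mem_suns hp hpy hpA
    have m2 : D ∈ suns G (A \ {y}) := by
      refine mem_suns.2 ⟨fun z hz => ?_, h.left_sun, fun u hu w hw ha => ?_⟩
      · simp only [Finset.mem_sdiff, Finset.mem_singleton]
        exact ⟨(hD z hz).1, fun e => hyD (e ▸ hz)⟩
      · simp only [Finset.mem_sdiff, Finset.mem_singleton] at hw
        exact (h1 u hu w hw.1 ha).resolve_right fun e => hw.2 e.2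
    have := hA.eq_of_mem (hE y h.right_mem).1 m1 m2
    have hxp : x ∈ ({p} : Finset V) := this ▸ h.left_mem
    rw [Finset.mem_singleton] at hxp
    subst hxp
    obtain ⟨w, hw, hwy, ha⟩ := hx y
    exact hwy (hpA w hw ha)
  · have := hconn (D ∪ E) (fun z hz => by
      rcases Finset.mem_union.1 hz with hz | hz
      · exact (hD z hz).1
      · exact (hE z hz).1) ⟨x, Finset.mem_union_left _ h.left_mem⟩ (by
      intro u hu w hw ha
      rw [Finset.mem_union]
      rcases Finset.mem_union.1 hu with hu | hu
      · rcases h1 u hu w hw ha with h3 | ⟨-, rfl⟩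
        · exact .inl h3
        · exact .inr h.right_mem
      · rcases h2 u hu w hw ha with h3 | ⟨-, rfl⟩
        · exact .inr h3
        · exact .inl h.left_mem)
    obtain ⟨s, hs⟩ := h.nonempty
    have hs' := h.subset hs
    rw [← this] at hs'
    rcases Finset.mem_union.1 hs' with h3 | h3
    · exact (hD s h3).2 hs
    · exact (hE s h3).2 hs

lemma suns_empty_of_sunCondition {A : Finset V} (hA : SunCondition G A) : suns G A = ∅ := by
  simpa using hA ∅ (Finset.empty_subset _)

lemma deleteEdges_adj_of_notMem {x y u v : V} {D : Finset V} (hy : y ∉ D) (hu : u ∈ D)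
    (hv : v ∈ D) : (G.deleteEdges {s(x, y)}).Adj u v ↔ G.Adj u v := by
  simp only [deleteEdges_adj, Set.mem_singleton_iff, Sym2.eq_iff, and_iff_left_iff_imp]
  rintro - (⟨-, rfl⟩ | ⟨rfl, -⟩)
  · exact hy hv
  · exact hy hu

lemma adj_out_of_closedIn_deleteEdges {x y u w : V} {A D : Finset V}
    (hc : ClosedIn (G.deleteEdges {s(x, y)}) A D) (hy : y ∉ D) (hu : u ∈ D) (hw : w ∈ A)
    (ha : G.Adj u w) : w ∈ D ∨ (u = x ∧ w = y) := by
  by_cases h : (G.deleteEdges {s(x, y)}).Adj u w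
  · exact .inl (hc u hu w hw h)
  · simp only [deleteEdges_adj, Set.mem_singleton_iff, Sym2.eq_iff, not_and, not_not] at h
    rcases h ha with h | ⟨rfl, -⟩
    · exact .inr h
    · exact (hy hu).elim

/-- A sun cut off by the edge `xy` has a pendant vertex at `x`. -/
lemma hasPendant_of_dangling {A D : Finset V} {x y : V}
    (ih : ∀ B : Finset V, B.card < A.card → SunCondition G B → PathCoverable G B)
    (hconn : ConnectedOn G A) (hA : SunCondition G A) (hA' : StrictSunCondition G A)
    (hcov : ¬ PathCoverable G A) (hxy : G.Adj x y) (hyA : y ∈ A) (hDA : D ⊆ A) (hD : IsSun G D)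
    (hxD : x ∈ D) (hyD : y ∉ D)
    (hout : ∀ u ∈ D, ∀ w ∈ A, G.Adj u w → w ∈ D ∨ (u = x ∧ w = y))
    (hx : HasTwoNeighbors G A x) (hy : HasTwoNeighbors G A y) : HasPendant G A x := by
  rcases hD.2 with ⟨v, rfl⟩ | ⟨R, σ, hc⟩
  · rw [Finset.mem_singleton] at hxD
    subst hxD
    obtain ⟨w, hw, hwy, ha⟩ := hx y
    rcases hout x (by simp) w hw ha with h | h
    · exact (ha.ne (Finset.mem_singleton.1 h).symm).elim
    · exact (hwy h.2).elim
  rcases hc.base_or_leaf hxD with ⟨R, σ, hc, hxR⟩ | ⟨R, σ, hc, r, hr, hxr, hR⟩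
  · refine ⟨σ x, hDA (hc.mem_leaf hxR), (hc.adj x hxR).symm, fun w hw ha => ?_⟩
    rcases hout _ (hc.mem_leaf hxR) w hw ha with h | h
    · exact hc.leaf x hxR w h ha
    · exact (hc.ne_leaf hxR hxR h.1.symm).elim
  exfalso
  -- Here `x` is a leaf of a corona other than `K₂`, so `D` without `x` is coverable; `x` is handed
  -- to the other side.
  set A' := insert x (A \ D) with hA'def
  have hmem : ∀ z, z ∈ A' ↔ z = x ∨ (z ∈ A ∧ z ∉ D) := by intro z; simp [hA'def]
  have hcD : PathCoverable G (D.erase x) := hxr ▸ hc.pathCoverable_erase_leaf hr hR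
  have hrx : r ≠ x := hxr ▸ hc.ne_leaf hr hr
  by_cases hcond : SunCondition G A'
  · have hlt : A'.card < A.card := by
      refine Finset.card_lt_card ⟨fun z hz => ?_, fun h => ?_⟩
      · rcases (hmem z).1 hz with rfl | h
        · exact hDA hxD
        · exact h.1
      · rcases (hmem r).1 (h (hDA (hc.mem_base hr))) with h | h
        · exact hrx h
        · exact h.2 (hc.mem_base hr)
    refine hcov ?_
    convert (ih A' hlt hcond).union hcD ?_ using 1
    · ext z
      rw [Finset.mem_union, hmem, Finset.mem_erase]
      have := @hDA z
      grind
    · rw [Finset.disjoint_left]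
      intro z hz
      rw [hmem] at hz
      rw [Finset.mem_erase]
      grind
  · simp only [SunCondition, not_forall, not_le] at hcond
    obtain ⟨X, hX, hlt⟩ := hcond
    have h1 : ∀ E ∈ suns G (A' \ X), x ∉ E → E ∈ suns G (A \ X) := by
      intro E hE hxE
      obtain ⟨hE1, hE2, hE3⟩ := mem_suns.1 hE
      have hE4 : ∀ z ∈ E, z ∈ A ∧ z ∉ D ∧ z ∉ X := by
        intro z hz
        have := Finset.mem_sdiff.1 (hE1 hz)
        rw [hmem] at this
        grind
      refine mem_suns.2 ⟨fun z hz => Finset.mem_sdiff.2 ⟨(hE4 z hz).1, (hE4 z hz).2.2⟩, hE2,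
        fun u hu w hw ha => ?_⟩
      rw [Finset.mem_sdiff] at hw
      refine hE3 u hu w (Finset.mem_sdiff.2 ⟨(hmem w).2 ?_, hw.2⟩) ha
      by_cases hwD : w ∈ D
      · rcases hout w hwD u (hE4 u hu).1 ha.symm with h | h
        · exact ((hE4 u hu).2.1 h).elim
        · exact .inl h.1
      · exact .inr ⟨hw.1, hwD⟩
    -- At most one sun of `A' \ X` contains `x`, and the others are suns of `A \ X`. For nonempty
    -- `X` strictness absorbs the extra one, so only `X = ∅` can be a violation.
    by_cases hXne : X.Nonempty
    · have h2 : suns G (A' \ X) ⊆ suns G (A \ X) ∪ (suns G (A' \ X)).filter (x ∈ ·) := by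
        intro E hE
        rw [Finset.mem_union, Finset.mem_filter]
        by_cases hxE : x ∈ E
        · exact .inr ⟨hE, hxE⟩
        · exact .inl (h1 E hE hxE)
      have h3 : ((suns G (A' \ X)).filter (x ∈ ·)).card ≤ 1 := by
        refine Finset.card_le_one.2 fun E hE E' hE' => ?_
        rw [Finset.mem_filter] at hE hE'
        exact suns_eq_of_mem hE.1 hE'.1 hE.2 hE'.2
      have h4 := Finset.card_le_card h2
      have h5 := Finset.card_union_le (suns G (A \ X)) ((suns G (A' \ X)).filter (x ∈ ·))
      have hXA : X ⊆ A := fun z hz => by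
        rcases (hmem z).1 (hX hz) with rfl | h
        · exact hDA hxD
        · exact h.1
      have h6 := hA' X hXA hXne
      omega
    · rw [Finset.not_nonempty_iff_eq_empty] at hXne
      subst hXne
      simp only [Finset.sdiff_empty, Finset.card_empty, mul_zero] at h1 hlt
      obtain ⟨E, hE⟩ := Finset.card_pos.1 hlt
      have hxE : x ∈ E := by
        by_contra hxE
        have := h1 E hE hxE
        rw [suns_empty_of_sunCondition hA] at this
        simp at this
      obtain ⟨hE1, hE2, hE3⟩ := mem_suns.1 hE
      have hyA' : y ∈ A' := (hmem y).2 (.inr ⟨hyA, hyD⟩)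
      have hyE : y ∈ E := hE3 x hxE y hyA' hxy
      have hEA : E = A' := by
        have := hconn (E ∪ D) (fun z hz => by
          rcases Finset.mem_union.1 hz with hz | hz
          · rcases (hmem z).1 (hE1 hz) with rfl | h
            · exact hDA hxD
            · exact h.1
          · exact hDA hz) ⟨x, Finset.mem_union_left _ hxE⟩ (by
          intro u hu w hw ha
          rw [Finset.mem_union]
          by_cases hwD : w ∈ D
          · exact .inr hwD
          · have hwA' : w ∈ A' := (hmem w).2 (.inr ⟨hw, hwD⟩)
            rcases Finset.mem_union.1 hu with hu | hu
            · exact .inl (hE3 u hu w hwA' ha)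
            · rcases hout u hu w hw ha with h | h
              · exact .inr h
              · exact .inl (h.2 ▸ hyE))
        refine Finset.Subset.antisymm hE1 fun z hz => ?_
        rcases (hmem z).1 hz with rfl | h
        · exact hxE
        · have := this ▸ h.1
          exact (Finset.mem_union.1 this).resolve_right h.2
      rw [hEA] at hE2 hxE hyE
      have hnbr : ∀ w ∈ A', G.Adj x w → w = y := by
        intro w hw ha
        rcases (hmem w).1 hw with rfl | h
        · exact (G.irrefl ha).elim
        · rcases hout x hxD w h.1 ha with h' | h'
          · exact (h.2 h').elim
          · exact h'.2
      rcases hE2.2 with ⟨v, hv⟩ | ⟨R', σ', hc'⟩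
      · rw [hv, Finset.mem_singleton] at hxE hyE
        exact hxy.ne (hxE.trans hyE.symm)
      -- In `A'` the only neighbour of `x` is `y`. As `y` has a second neighbour, it is not a leaf
      -- at `x`; so `x` is the leaf at `y`, and the path `y, x, r` links the two coronas, whose
      -- remaining pairs are coverable.
      rcases (hc'.mem_iff x).1 hxE with hxR' | ⟨t, ht, htx⟩
      · have h2 := hnbr _ (hc'.mem_leaf hxR') (hc'.adj x hxR')
        obtain ⟨w, hw, hwx, ha⟩ := hy x
        have hwD : w ∉ D := fun hwD => by
          rcases hout w hwD y hyA ha.symm with h | h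
          · exact hyD h
          · exact hwx h.1
        exact hwx (hc'.leaf x hxR' w ((hmem w).2 (.inr ⟨hw, hwD⟩)) (h2 ▸ ha))
      · have h2 := hnbr t (hc'.mem_base ht) (htx ▸ (hc'.adj t ht).symm)
        subst h2
        have c1 := hc'.pathCoverable_erase_pair ht (A := (A'.erase t).erase x)
          (by intro z; simp [htx]; tauto)
        have c2 := hc.pathCoverable_erase_pair hr (A := (D.erase r).erase x)
          (by intro z; simp [← hxr]; tauto)
        have c3 := c1.union c2 (by
          rw [Finset.disjoint_left]
          intro z hz
          simp only [Finset.mem_erase, hmem] at hz ⊢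
          grind)
        have hxr' : G.Adj x r := hxr ▸ (hc.adj r hr).symm
        have hrD := hc.mem_base hr
        refine hcov (c3.of_path (l := [t, x, r]) ⟨by simp [hxy.symm, hxr'], ?_⟩ (by simp) ?_ ?_)
        · have := hxy.ne'
          simp
          grind
        · intro z hz
          simp only [List.mem_cons, List.not_mem_nil, or_false] at hz
          simp only [Finset.mem_union, Finset.mem_erase, hmem]
          grind
        · intro z
          have := @hDA z
          simp only [List.mem_cons, List.not_mem_nil, or_false, Finset.mem_union,
            Finset.mem_erase, hmem]
          grind

/-- The alternatives for an edge both of whose ends have two neighbours. -/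
lemma hasPendant_of_edge {A : Finset V} {x y : V}
    (ih : ∀ B : Finset V, B.card < A.card → SunCondition G B → PathCoverable G B)
    (ihe : SunCondition (G.deleteEdges {s(x, y)}) A →
      PathCoverable (G.deleteEdges {s(x, y)}) A)
    (hconn : ConnectedOn G A) (hA : SunCondition G A) (hA' : StrictSunCondition G A)
    (hcov : ¬ PathCoverable G A) (hxy : G.Adj x y) (hxA : x ∈ A) (hyA : y ∈ A)
    (hx : HasTwoNeighbors G A x) (hy : HasTwoNeighbors G A y) :
    HasPendant G A y ∨ Dangles G A x y := by
  set G' := G.deleteEdges {s(x, y)} with hG'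
  have hle : G' ≤ G := G.deleteEdges_le _
  have hncond : ¬ SunCondition G' A := fun h => hcov ((ihe h).mono hle)
  simp only [SunCondition, not_forall, not_le] at hncond
  obtain ⟨S, hS, hlt⟩ := hncond
  have hswap : G' = G.deleteEdges {s(y, x)} := by rw [hG', Sym2.eq_swap]
  have hkeep : ∀ D ∈ suns G' (A \ S), x ∉ D → y ∉ D → D ∈ suns G (A \ S) := by
    intro D hD hxD hyD
    obtain ⟨h1, h2, h3⟩ := mem_suns.1 hD
    refine mem_suns.2 ⟨h1, h2.congr fun u hu v hv => deleteEdges_adj_of_notMem hyD hu hv, ?_⟩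
    intro u hu w hw ha
    refine (adj_out_of_closedIn_deleteEdges h3 hyD hu hw ha).resolve_right ?_
    rintro ⟨rfl, -⟩
    exact hxD hu
  have hlt2 : ((suns G' (A \ S)).filter fun D => x ∈ D).card ≤ 1 ∧
      ((suns G' (A \ S)).filter fun D => y ∈ D).card ≤ 1 := by
    constructor <;>
    · refine Finset.card_le_one.2 fun E hE E' hE' => ?_
      rw [Finset.mem_filter] at hE hE'
      exact suns_eq_of_mem hE.1 hE'.1 hE.2 hE'.2
  set 𝒟 := (suns G' (A \ S)).filter fun D => x ∉ D ∧ y ∉ D with h𝒟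
  have h𝒟sub : 𝒟 ⊆ suns G (A \ S) := fun D hD => by
    rw [h𝒟, Finset.mem_filter] at hD
    exact hkeep D hD.1 hD.2.1 hD.2.2
  -- Only the suns at `x` and `y` can be lost when `xy` is restored, and strictness leaves at most
  -- `2|S| - 1` others. Hence both exist, are distinct, and `𝒟` has exactly `2|S| - 1` members.
  by_cases hSne : S.Nonempty
  · have hst := hA' S hS hSne
    have h1 := Finset.card_le_card h𝒟sub
    have h2 : suns G' (A \ S) ⊆ 𝒟 ∪ ((suns G' (A \ S)).filter (fun D => x ∈ D) ∪
        (suns G' (A \ S)).filter fun D => y ∈ D) := by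
      intro D hD
      simp only [h𝒟, Finset.mem_union, Finset.mem_filter]
      tauto
    have h3 := Finset.card_le_card h2
    have h4 := Finset.card_union_le 𝒟 ((suns G' (A \ S)).filter (fun D => x ∈ D) ∪
        (suns G' (A \ S)).filter fun D => y ∈ D)
    have h5 := Finset.card_union_le ((suns G' (A \ S)).filter (fun D => x ∈ D))
        ((suns G' (A \ S)).filter fun D => y ∈ D)
    obtain ⟨D, hD⟩ : ((suns G' (A \ S)).filter fun D => x ∈ D).Nonempty :=
      Finset.card_pos.1 (by omega)
    obtain ⟨E, hE⟩ : ((suns G' (A \ S)).filter fun D => y ∈ D).Nonempty :=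
      Finset.card_pos.1 (by omega)
    rw [Finset.mem_filter] at hD hE
    have hDE : D ≠ E := by
      rintro rfl
      have h6 : ((suns G' (A \ S)).filter (fun D => x ∈ D) ∪
          (suns G' (A \ S)).filter fun D => y ∈ D).card ≤ 1 := by
        refine Finset.card_le_one_iff_subset_singleton.2 ⟨D, fun B hB => ?_⟩
        rw [Finset.mem_singleton]
        simp only [Finset.mem_union, Finset.mem_filter] at hB
        rcases hB with hB | hB
        · exact suns_eq_of_mem hB.1 hD.1 hB.2 hD.2
        · exact suns_eq_of_mem hB.1 hE.1 hB.2 hE.2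
      omega
    have hdis := suns_disjoint hD.1 hE.1 hDE
    have hyD : y ∉ D := fun h => Finset.disjoint_left.1 hdis h hE.2
    have hxE : x ∉ E := fun h => Finset.disjoint_left.1 hdis hD.2 h
    obtain ⟨hD1, hD2, hD3⟩ := mem_suns.1 hD.1
    obtain ⟨hE1, hE2, hE3⟩ := mem_suns.1 hE.1
    have hDout : ∀ u ∈ D, ∀ w ∈ A \ S, G.Adj u w → w ∈ D ∨ (u = x ∧ w = y) :=
      fun u hu w hw ha => adj_out_of_closedIn_deleteEdges hD3 hyD hu hw ha
    have hEout : ∀ u ∈ E, ∀ w ∈ A \ S, G.Adj u w → w ∈ E ∨ (u = y ∧ w = x) :=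
      fun u hu w hw ha => adj_out_of_closedIn_deleteEdges (hswap ▸ hE3) hxE hu hw ha
    have split : EdgeSplit G A S D E x y :=
      { subset := hS
        nonempty := hSne
        left_subset := hD1
        right_subset := hE1
        disjoint := hdis
        left_sun := hD2.congr fun u hu v hv => deleteEdges_adj_of_notMem hyD hu hv
        right_sun := (hswap ▸ hE2).congr fun u hu v hv => deleteEdges_adj_of_notMem hxE hu hv
        left_mem := hD.2
        right_mem := hE.2
        adj := hxy
        left_out := hDout
        right_out := hEout
        hangsAt := fun s hs => by
          refine hangsAt_of_strict (𝒟 := 𝒟) ih hA hA' hS hs (Finset.union_subset hD1 hE1) ?_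
            h𝒟sub ?_ (by omega)
          · intro u hu w hw ha
            rw [Finset.mem_union]
            rcases Finset.mem_union.1 hu with hu | hu
            · rcases hDout u hu w hw ha with h | ⟨-, rfl⟩
              · exact .inl h
              · exact .inr hE.2
            · rcases hEout u hu w hw ha with h | ⟨-, rfl⟩
              · exact .inr h
              · exact .inl hD.2
          · intro B hB
            rw [h𝒟, Finset.mem_filter] at hB
            rw [Finset.disjoint_union_right]
            exact ⟨suns_disjoint hB.1 hD.1 fun h => hB.2.1 (h ▸ hD.2),
              suns_disjoint hB.1 hE.1 fun h => hB.2.2 (h ▸ hE.2)⟩ }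
    exact .inl (split.symm.hasPendant hcov hconn hA' hy hx)
  · rw [Finset.not_nonempty_iff_eq_empty] at hSne
    subst hSne
    simp only [Finset.sdiff_empty, Finset.card_empty, mul_zero] at hlt hkeep
    obtain ⟨D, hD⟩ := Finset.card_pos.1 hlt
    obtain ⟨hD1, hD2, hD3⟩ := mem_suns.1 hD
    by_cases hxD : x ∈ D
    · by_cases hyD : y ∈ D
      · exfalso
        have hDA : D = A := by
          refine hconn D hD1 ⟨x, hxD⟩ fun u hu w hw ha => ?_
          by_cases h : G'.Adj u w
          · exact hD3 u hu w hw h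
          · simp only [hG', deleteEdges_adj, Set.mem_singleton_iff, Sym2.eq_iff, not_and,
              not_not] at h
            rcases h ha with ⟨-, rfl⟩ | ⟨-, rfl⟩
            · exact hyD
            · exact hxD
        subst hDA
        rcases hD2.2 with ⟨v, rfl⟩ | ⟨R, σ, hc⟩
        · rw [Finset.mem_singleton] at hxD hyD
          exact hxy.ne (hxD.trans hyD.symm)
        have hnxy : ¬ G'.Adj x y := by simp [hG']
        -- Restoring an edge between base vertices keeps a corona, so `A` would be a sun; restoring
        -- an edge at a leaf makes it coverable.
        rcases (hc.mem_iff x).1 hxD with hxR | ⟨r, hr, rfl⟩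
        · rcases (hc.mem_iff y).1 hyD with hyR | ⟨r, hr, rfl⟩
          · have hcG : IsCorona G D R σ :=
              { nonempty := hc.nonempty
                mem_iff := hc.mem_iff
                inj := hc.inj
                notMem := hc.notMem
                adj := fun r hr => hle (hc.adj r hr)
                leaf := fun r hr z hz ha => by
                  refine hc.leaf r hr z hz ?_
                  simp only [hG', deleteEdges_adj, Set.mem_singleton_iff, Sym2.eq_iff]
                  refine ⟨ha, ?_⟩
                  rintro (⟨h, -⟩ | ⟨h, -⟩)
                  · exact hc.notMem r hr (h ▸ hxR)
                  · exact hc.notMem r hr (h ▸ hyR)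
                crit := fun r hr => (hc.crit r hr).mono fun _ _ _ _ h => hle h }
            have : D ∈ suns G D := mem_suns.2 ⟨Finset.Subset.refl _,
              ⟨hconn, .inr ⟨R, σ, hcG⟩⟩, fun _ _ w hw _ => hw⟩
            rw [suns_empty_of_sunCondition hA] at this
            simp at this
          · refine hcov (hc.pathCoverable_of_extra_edge hle hr hxD ?_ hxy.symm)
            rintro rfl
            exact hnxy (hc.adj x hr)
        · refine hcov (hc.pathCoverable_of_extra_edge hle hr hyD ?_ hxy)
          rintro rfl
          exact hnxy (hc.adj y hr).symm
      · have hDG := hD2.congr fun u hu v hv => deleteEdges_adj_of_notMem (G := G) (x := x) hyD hu hv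
        have hout : ∀ u ∈ D, ∀ w ∈ A, G.Adj u w → w ∈ D ∨ (u = x ∧ w = y) :=
          fun u hu w hw ha => adj_out_of_closedIn_deleteEdges hD3 hyD hu hw ha
        refine .inr ⟨D, mem_suns.2 ⟨fun z hz => ?_, hDG, fun u hu w hw ha => ?_⟩, hxD,
          fun z hz ha => ((hout z hz y hyA ha).resolve_left hyD).1⟩
        · rw [Finset.mem_sdiff, Finset.mem_singleton]
          exact ⟨hD1 hz, fun e => hyD (e ▸ hz)⟩
        · rw [Finset.mem_sdiff, Finset.mem_singleton] at hw
          exact (hout u hu w hw.1 ha).resolve_right fun e => hw.2 e.2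
    · by_cases hyD : y ∈ D
      · have hDG := (hswap ▸ hD2).congr fun u hu v hv =>
          deleteEdges_adj_of_notMem (G := G) (x := y) hxD hu hv
        have hout : ∀ u ∈ D, ∀ w ∈ A, G.Adj u w → w ∈ D ∨ (u = y ∧ w = x) :=
          fun u hu w hw ha => adj_out_of_closedIn_deleteEdges (hswap ▸ hD3) hxD hu hw ha
        exact .inl (hasPendant_of_dangling ih hconn hA hA' hcov hxy.symm hxA hD1 hDG hyD hxD hout
          hy hx)
      · have := hkeep D hD hxD hyD
        rw [suns_empty_of_sunCondition hA] at this
        simp at this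

/-! ### The end of the proof of Kaneko's theorem -/

/-- If every vertex with two neighbours has a pendant one, then `A` would be a sun. -/
lemma pathCoverable_of_strict {A : Finset V}
    (ih : ∀ B : Finset V, B.card < A.card → SunCondition G B → PathCoverable G B)
    (ihe : ∀ x ∈ A, ∀ y ∈ A, G.Adj x y → SunCondition (G.deleteEdges {s(x, y)}) A →
      PathCoverable (G.deleteEdges {s(x, y)}) A)
    (hconn : ConnectedOn G A) (hA : SunCondition G A) (hA' : StrictSunCondition G A)
    (hne : A.Nonempty) : PathCoverable G A := by
  classical
  by_contra hcov
  have hnsun : ¬ IsSun G A := fun h => by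
    have : A ∈ suns G A := mem_suns.2 ⟨Finset.Subset.refl _, h, fun _ _ w hw _ => hw⟩
    rw [suns_empty_of_sunCondition hA] at this
    simp at this
  have hpend : ∀ y ∈ A, HasTwoNeighbors G A y → HasPendant G A y := by
    intro y hyA hy
    by_contra hny
    -- Without a pendant vertex at `y`, every edge at `y` dangles. But `A \ {y}` has at most one
    -- sun, and that sun cannot be attached to `y` solely at each of two different neighbours.
    have key : ∀ x ∈ A, G.Adj x y → Dangles G A x y := by
      intro x hx hxy
      by_cases hx2 : HasTwoNeighbors G A x
      · exact (hasPendant_of_edge ih (ihe x hx y hyA hxy) hconn hA hA' hcov hxy hx hyA hx2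
          hy).resolve_left hny
      · simp only [HasTwoNeighbors, not_forall, not_exists, not_and] at hx2
        obtain ⟨u, hu⟩ := hx2
        have hyu : y = u := by
          by_contra h
          exact hu y hyA h hxy
        subst hyu
        refine (hny ⟨x, hx, hxy, fun w hw ha => ?_⟩).elim
        by_contra h
        exact hu w hw h ha
    obtain ⟨w₁, hw₁, -, ha₁⟩ := hy y
    obtain ⟨w₂, hw₂, hne', ha₂⟩ := hy w₁
    obtain ⟨D₁, hD₁, -, h₁⟩ := key w₁ hw₁ ha₁.symm
    obtain ⟨D₂, hD₂, hm₂, -⟩ := key w₂ hw₂ ha₂.symm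
    have := hA'.eq_of_mem hyA hD₁ hD₂
    subst this
    exact hne' (h₁ w₂ hm₂ ha₂.symm)
  choose! σ hσA hσ hσ' using hpend
  -- These vertices form the base of a corona filling `A`; their pendant neighbours, chosen by `σ`,
  -- are the leaves.
  set Q := A.filter fun v => HasTwoNeighbors G A v with hQ
  have hQm : ∀ z, z ∈ Q ↔ z ∈ A ∧ HasTwoNeighbors G A z := by intro z; rw [hQ, Finset.mem_filter]
  have hnQ : ∀ r ∈ Q, σ r ∉ Q := by
    intro r hr h
    rw [hQm] at hr h
    obtain ⟨w, hw, hwr, ha⟩ := h.2 r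
    exact hwr (hσ' r hr.1 hr.2 w hw ha)
  have hinj : ∀ r ∈ Q, ∀ s ∈ Q, σ r = σ s → r = s := by
    intro r hr s hs h
    rw [hQm] at hr hs
    refine hσ' s hs.1 hs.2 r hr.1 ?_
    rw [← h]
    exact hσ r hr.1 hr.2
  have hleafQ : ∀ z ∈ A, z ∉ Q → ∃ r ∈ Q, σ r = z := by
    intro z hz hzQ
    simp only [hQm, hz, true_and, HasTwoNeighbors, not_forall, not_exists, not_and] at hzQ
    obtain ⟨u, hu⟩ := hzQ
    have hu' : ∀ w ∈ A, G.Adj z w → w = u := fun w hw ha => by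
      by_contra h
      exact hu w hw h ha
    by_cases hzu : u ∈ A ∧ G.Adj z u
    · obtain ⟨huA, hzu⟩ := hzu
      by_cases huQ : u ∈ Q
      · have huQ' := (hQm u).1 huQ
        refine ⟨u, huQ, ?_⟩
        have h1 := singleton_mem_suns hz hzu hu'
        have h2 := singleton_mem_suns (hσA u huA huQ'.2) (hσ u huA huQ'.2) (hσ' u huA huQ'.2)
        simpa using hA'.eq_of_mem huA h2 h1
      · exfalso
        simp only [hQm, huA, true_and, HasTwoNeighbors, not_forall, not_exists, not_and] at huQ
        obtain ⟨t, ht⟩ := huQ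
        have ht' : ∀ w ∈ A, G.Adj u w → w = z := fun w hw ha => by
          have h1 : w = t := by
            by_contra h
            exact ht w hw h ha
          have h2 : z = t := by
            by_contra h
            exact ht z hz h hzu.symm
          rw [h1, h2]
        have hAe : {z, u} = A := by
          refine hconn _ (by simp [Finset.insert_subset_iff, hz, huA]) (by simp) ?_
          intro a ha w hw haw
          simp only [Finset.mem_insert, Finset.mem_singleton] at ha ⊢
          rcases ha with rfl | rfl
          · exact .inr (hu' w hw haw)
          · exact .inl (ht' w hw haw)
        refine hnsun ⟨hconn, .inr ⟨{z}, fun _ => u, ?_⟩⟩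
        refine ⟨by simp, ?_, by simp, ?_, ?_, ?_, ?_⟩
        · intro w; rw [← hAe]; simp [eq_comm]
        · simpa using hzu.ne'
        · simpa using hzu
        · intro r hr w hw ha
          rw [Finset.mem_singleton] at hr
          subst hr
          exact ht' w hw ha
        · simpa using PerfectlyMatched.empty
    · exfalso
      have hAe : {z} = A := by
        refine hconn _ (by simpa using hz) (by simp) ?_
        intro a ha w hw haw
        rw [Finset.mem_singleton] at ha
        subst ha
        exact (hzu ⟨hu' w hw haw ▸ hw, hu' w hw haw ▸ haw⟩).elim
      exact hnsun (hAe ▸ isSun_singleton z)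
  have hmem : ∀ z, z ∈ A ↔ z ∈ Q ∨ ∃ r ∈ Q, σ r = z := by
    intro z
    constructor
    · intro hz
      by_cases hzQ : z ∈ Q
      · exact .inl hzQ
      · exact .inr (hleafQ z hz hzQ)
    · rintro (h | ⟨r, hr, rfl⟩)
      · exact ((hQm z).1 h).1
      · rw [hQm] at hr
        exact hσA r hr.1 hr.2
  refine hnsun ⟨hconn, .inr ⟨Q, σ, ?_, hmem, hinj, hnQ, ?_, ?_, ?_⟩⟩
  · obtain ⟨z, hz⟩ := hne
    rcases (hmem z).1 hz with h | ⟨r, hr, -⟩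
    · exact ⟨z, h⟩
    · exact ⟨r, hr⟩
  · intro r hr
    rw [hQm] at hr
    exact (hσ r hr.1 hr.2).symm
  · intro r hr w hw ha
    rw [hQm] at hr
    exact hσ' r hr.1 hr.2 w hw ha
  · intro r hr
    have hr' := (hQm r).1 hr
    have hσr := hσA r hr'.1 hr'.2
    have hrσ : r ≠ σ r := (hσ r hr'.1 hr'.2).ne'
    -- Factor-criticality at `r`: a covering of what is left without the pair at `r` induces the
    -- matching of the remaining base.
    set B := (A.erase r).erase (σ r) with hB
    have hBm : ∀ z, z ∈ B ↔ z ∈ A ∧ z ≠ r ∧ z ≠ σ r := by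
      intro z; simp [hB]; tauto
    have hBcov : PathCoverable G B := by
      refine ih B ?_ fun X hX => ?_
      · exact Finset.card_lt_card ⟨fun z hz => ((hBm z).1 hz).1, fun h =>
          ((hBm r).1 (h hr'.1)).2.1 rfl⟩
      · have hrX : r ∉ X := fun h => ((hBm r).1 (hX h)).2.1 rfl
        have hσX : σ r ∉ X := fun h => ((hBm _).1 (hX h)).2.2 rfl
        -- Deleting `r` with `X` isolates `σ r`, which is one more sun; the strict bound for `insert
        -- r X` thus leaves at most `2|X|` suns in `B \ X`.
        have h1 : insert {σ r} (suns G (B \ X)) ⊆ suns G (A \ insert r X) := by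
          intro D hD
          rcases Finset.mem_insert.1 hD with rfl | hD
          · refine mem_suns.2 ⟨?_, isSun_singleton _, ?_⟩
            · simp [hσr, hrσ.symm, hσX]
            · intro u hu w hw ha
              rw [Finset.mem_singleton] at hu
              subst hu
              rw [Finset.mem_sdiff] at hw
              have := hσ' r hr'.1 hr'.2 w hw.1 ha
              simp [this] at hw
          · obtain ⟨h1, h2, h3⟩ := mem_suns.1 hD
            have h4 : ∀ z ∈ D, (z ∈ A ∧ z ≠ r ∧ z ≠ σ r) ∧ z ∉ X := fun z hz => by
              have := Finset.mem_sdiff.1 (h1 hz)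
              rwa [hBm] at this
            refine mem_suns.2 ⟨fun z hz => ?_, h2, fun u hu w hw ha => ?_⟩
            · have := h4 z hz
              simp [this]
            · simp only [Finset.mem_sdiff, Finset.mem_insert, not_or] at hw
              refine h3 u hu w (Finset.mem_sdiff.2 ⟨(hBm w).2 ⟨hw.1, hw.2.1, ?_⟩, hw.2.2⟩) ha
              rintro rfl
              exact (h4 u hu).1.2.1 (hσ' r hr'.1 hr'.2 u (h4 u hu).1.1 ha.symm)
        have h2 := Finset.card_le_card h1
        rw [Finset.card_insert_of_notMem (fun h => by
          have := Finset.mem_sdiff.1 ((mem_suns.1 h).1 (Finset.mem_singleton_self _))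
          exact ((hBm _).1 this.1).2.2 rfl)] at h2
        have h3 := hA' (insert r X) (by
          intro z hz
          rcases Finset.mem_insert.1 hz with rfl | hz
          · exact hr'.1
          · exact ((hBm z).1 (hX hz)).1) (by simp)
        rw [Finset.card_insert_of_notMem hrX] at h3
        omega
    refine hBcov.perfectlyMatched (σ := σ) ?_ ?_ ?_ ?_
    · intro z
      rw [hBm, hmem]
      have h1 := hinj r hr
      have h2 := hnQ
      clear hσA hσ hσ'
      constructor
      · rintro ⟨h | ⟨t, ht, rfl⟩, h3, h4⟩
        · exact .inl (Finset.mem_erase.2 ⟨h3, h⟩)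
        · exact .inr ⟨t, Finset.mem_erase.2 ⟨fun e => h4 (e ▸ rfl), ht⟩, rfl⟩
      · rintro (h | ⟨t, ht, rfl⟩)
        · rw [Finset.mem_erase] at h
          exact ⟨.inl h.2, h.1, fun e => h2 r hr (e ▸ h.2)⟩
        · rw [Finset.mem_erase] at ht
          exact ⟨.inr ⟨t, ht.2, rfl⟩, fun e => h2 t ht.2 (e ▸ hr), fun e => ht.1 (h1 t ht.2 e.symm).symm⟩
    · exact fun a ha b hb => hinj a (Finset.mem_of_mem_erase ha) b (Finset.mem_of_mem_erase hb)
    · exact fun a ha h => hnQ a (Finset.mem_of_mem_erase ha) (Finset.mem_of_mem_erase h)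
    · intro a ha w hw haw
      have := (hQm a).1 (Finset.mem_of_mem_erase ha)
      exact hσ' a this.1 this.2 w ((hBm w).1 hw).1 haw

/-- A disconnected `A` is covered part by part. A connected one either has a nonempty set with
equality or satisfies the strict condition. -/
lemma pathCoverable_step {A : Finset V}
    (ih : ∀ B : Finset V, B.card < A.card → SunCondition G B → PathCoverable G B)
    (ihe : ∀ x ∈ A, ∀ y ∈ A, G.Adj x y → SunCondition (G.deleteEdges {s(x, y)}) A →
      PathCoverable (G.deleteEdges {s(x, y)}) A)
    (hA : SunCondition G A) : PathCoverable G A := by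
  by_cases hne : A.Nonempty
  swap
  · rw [Finset.not_nonempty_iff_eq_empty.1 hne]; exact .empty
  by_cases hconn : ConnectedOn G A
  · by_cases hA' : StrictSunCondition G A
    · exact pathCoverable_of_strict ih ihe hconn hA hA' hne
    · simp only [StrictSunCondition, not_forall] at hA'
      obtain ⟨S, hS, hSne, hlt⟩ := hA'
      have := hA S hS
      exact pathCoverable_of_tight ih hA hS hSne (by omega)
  · simp only [ConnectedOn, not_forall] at hconn
    obtain ⟨D, hD, hDne, hcl, hDA⟩ := hconn
    have part : ∀ B ⊆ A, B ≠ A → ClosedIn G A B → PathCoverable G B := by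
      intro B hB hBA hBc
      refine ih B (Finset.card_lt_card (hB.ssubset_of_ne hBA)) fun X hX => ?_
      refine (Finset.card_le_card fun E hE => ?_).trans (hA X (hX.trans hB))
      obtain ⟨h1, h2, h3⟩ := mem_suns.1 hE
      refine mem_suns.2 ⟨h1.trans (Finset.sdiff_subset_sdiff hB (Finset.Subset.refl _)), h2,
        fun u hu w hw ha => ?_⟩
      have hu' := (Finset.mem_sdiff.1 (h1 hu)).1
      rw [Finset.mem_sdiff] at hw
      exact h3 u hu w (Finset.mem_sdiff.2 ⟨hBc u hu' w hw.1 ha, hw.2⟩) ha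
    have := (part D hD hDA hcl).union (part (A \ D) Finset.sdiff_subset ?_ ?_)
      Finset.disjoint_sdiff
    · rwa [Finset.union_sdiff_of_subset hD] at this
    · intro h
      obtain ⟨z, hz⟩ := hDne
      have := hD hz
      rw [← h] at this
      exact (Finset.mem_sdiff.1 this).2 hz
    · intro u hu w hw ha
      rw [Finset.mem_sdiff] at hu ⊢
      exact ⟨hw, fun hwD => hu.2 (hcl w hwD u hu.1 ha.symm)⟩

/-- Kaneko's theorem: if deleting any set `S` leaves at most `2|S|` sun components, then the graph
can be covered by disjoint paths of order at least `3`. -/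
theorem pathCoverable_of_sunCondition (A : Finset V) (G : SimpleGraph V)
    (hA : SunCondition G A) : PathCoverable G A := by
  classical
  induction hn : A.card using Nat.strong_induction_on generalizing A G with
  | _ n ih =>
  subst hn
  -- Inner induction on the number of ordered adjacent pairs in `A`, for deleting edges at fixed
  -- `A`.
  induction hm : ((A ×ˢ A).filter fun p => G.Adj p.1 p.2).card using Nat.strong_induction_on
    generalizing G with
  | _ m ihe =>
  subst hm
  refine pathCoverable_step (fun B hB hBc => ih _ hB B G hBc rfl) (fun x hx y hy hxy hc => ?_) hA
  refine ihe _ ?_ _ hc rfl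
  refine Finset.card_lt_card ⟨fun p hp => ?_, fun h => ?_⟩
  · simp only [Finset.mem_filter] at hp ⊢
    exact ⟨hp.1, G.deleteEdges_le _ hp.2⟩
  · have := h (Finset.mem_filter.2 ⟨Finset.mk_mem_product hx hy, hxy⟩)
    simp at this

/-! ### From coverings to path factors -/

/-- A component traversed by an injective sequence whose consecutive members are exactly the
adjacent vertices is a path. -/
lemma nonempty_iso_pathGraph {W : Type*} {H : SimpleGraph W} {m : ℕ} (g : Fin m → W)
    (hg : Function.Injective g)
    (hadj : ∀ i w, H.Adj (g i) w ↔ ∃ j, w = g j ∧ (pathGraph m).Adj i j) (i₀ : Fin m) :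
    Nonempty ((H.connectedComponentMk (g i₀)).toSimpleGraph ≃g pathGraph m) := by
  have hadj' : ∀ i j, H.Adj (g i) (g j) ↔ (pathGraph m).Adj i j := by
    intro i j
    rw [hadj]
    constructor
    · rintro ⟨k, hk, h⟩
      rwa [hg hk]
    · exact fun h => ⟨j, rfl, h⟩
  let φ : pathGraph m →g H := ⟨g, fun {a b} h => (hadj' a b).2 h⟩
  have hreach : ∀ i, H.Reachable (g i) (g i₀) := by
    intro i
    obtain ⟨n, rfl⟩ : ∃ n, m = n + 1 := ⟨m - 1, by have := i.2; omega⟩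
    exact ((pathGraph_connected n).preconnected i i₀).map φ
  have hsurj : ∀ u w, H.Walk u w → ∀ i, u = g i → ∃ j, w = g j := by
    intro u w p
    induction p with
    | nil => exact fun i hi => ⟨i, hi⟩
    | cons h _ ih =>
      rintro i rfl
      obtain ⟨j, rfl, -⟩ := (hadj i _).1 h
      exact ih j rfl
  let e : Fin m → (H.connectedComponentMk (g i₀)) := fun i =>
    ⟨g i, ConnectedComponent.eq.2 (hreach i)⟩
  have he : Function.Bijective e := by
    refine ⟨fun i j h => hg (congrArg Subtype.val h), fun ⟨w, hw⟩ => ?_⟩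
    obtain ⟨p⟩ := (ConnectedComponent.eq.1 hw).symm
    obtain ⟨j, rfl⟩ := hsurj _ _ p i₀ rfl
    exact ⟨j, rfl⟩
  exact ⟨(RelIso.mk (Equiv.ofBijective e he) (fun {a b} => hadj' a b)).symm⟩

/-- The graph joining consecutive members of a list without repetitions. -/
def listGraph (l : List V) (hl : l.Nodup) : SimpleGraph V where
  Adj u w := ∃ i, ∃ hi : i + 1 < l.length, (u = l[i] ∧ w = l[i + 1]) ∨ (w = l[i] ∧ u = l[i + 1])
  symm.symm u w := by rintro ⟨i, hi, h⟩; exact ⟨i, hi, h.symm⟩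
  loopless.irrefl u := by
    rintro ⟨i, hi, ⟨h1, h2⟩ | ⟨h1, h2⟩⟩ <;>
    · have := hl.getElem_inj_iff.1 (h1.symm.trans h2)
      omega

/-- Each vertex has its neighbours in `F` exactly as on its own list, which is what identifies the
components as paths. -/
lemma PathCoverable.exists_graph {A : Finset V} (h : PathCoverable G A) :
    ∃ F : SimpleGraph V, F ≤ G ∧ (∀ u w, F.Adj u w → u ∈ A) ∧ ∀ v ∈ A, ∃ l : List V,
      ∃ hl : l.Nodup, 3 ≤ l.length ∧ v ∈ l ∧ (∀ z ∈ l, z ∈ A) ∧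
        ∀ u ∈ l, ∀ w, F.Adj u w ↔ (listGraph l hl).Adj u w := by
  induction h with
  | empty => exact ⟨⊥, bot_le, by simp, by simp⟩
  | @cons l A hl h3 hd _ ih =>
    obtain ⟨F, hF, hFA, hFl⟩ := ih
    have hd' : ∀ z ∈ l, z ∉ A := fun z hz => Finset.disjoint_left.1 hd (List.mem_toFinset.2 hz)
    have hmem : ∀ u w, (listGraph l hl.2).Adj u w → u ∈ l := by
      rintro u w ⟨i, hi, ⟨rfl, -⟩ | ⟨-, rfl⟩⟩ <;> simp
    refine ⟨listGraph l hl.2 ⊔ F, sup_le ?_ hF, ?_, ?_⟩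
    · have hc := List.isChain_iff_getElem.1 hl.1
      rintro u w ⟨i, hi, ⟨rfl, rfl⟩ | ⟨rfl, rfl⟩⟩
      · exact hc i hi
      · exact (hc i hi).symm
    · rintro u w (h | h)
      · simp [hmem u w h]
      · simp [hFA u w h]
    · intro v hv
      rcases Finset.mem_union.1 hv with hv | hv
      · refine ⟨l, hl.2, h3, List.mem_toFinset.1 hv, by simp +contextual, fun u hu w => ?_⟩
        rw [sup_adj]
        exact or_iff_left fun h => hd' u hu (hFA u w h)
      · obtain ⟨l', hl', h3', hv', hA', hF'⟩ := hFl v hv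
        refine ⟨l', hl', h3', hv', fun z hz => Finset.mem_union_right _ (hA' z hz),
          fun u hu w => ?_⟩
        rw [sup_adj, ← hF' u hu w]
        exact or_iff_right fun h => hd' u (hmem u w h) (hA' u hu)

lemma PathCoverable.exists_isPathFactor {A : Finset V} {s : Set V} (hs : ∀ v, v ∈ A ↔ v ∈ s)
    (h : PathCoverable G A) : ∃ F, IsPathFactor 3 (G.induce s) F := by
  obtain ⟨F, hF, hFA, hFl⟩ := h.exists_graph
  refine ⟨F.induce s, fun u w h => hF h, fun C => ?_⟩
  induction C using ConnectedComponent.ind with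
  | _ v =>
  obtain ⟨l, hl, h3, hv, hA, hadj⟩ := hFl v ((hs _).2 v.2)
  refine ⟨l.length, by omega, h3, ?_⟩
  let g : Fin l.length → s := fun i => ⟨l[i], (hs _).1 (hA _ (by simp))⟩
  obtain ⟨i, hi, hiv⟩ := List.getElem_of_mem hv
  have hgi : g ⟨i, hi⟩ = v := Subtype.ext hiv
  rw [← hgi]
  refine nonempty_iso_pathGraph g (fun a b hab => ?_) (fun a w => ?_) _
  · exact Fin.ext (hl.getElem_inj_iff.1 (congrArg Subtype.val hab))
  · rw [comap_adj]
    change F.Adj l[a] w ↔ _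
    rw [hadj _ (by simp)]
    simp only [pathGraph_adj]
    constructor
    · rintro ⟨k, hk, ⟨h1, h2⟩ | ⟨h1, h2⟩⟩
      · have := hl.getElem_inj_iff.1 h1
        exact ⟨⟨k + 1, hk⟩, Subtype.ext h2, .inl (by simp [this])⟩
      · have := hl.getElem_inj_iff.1 h2
        exact ⟨⟨k, by omega⟩, Subtype.ext h1, .inr (by simp [this])⟩
    · rintro ⟨j, rfl, h | h⟩
      · exact ⟨a, by omega, .inl ⟨rfl, by simp [g, h]⟩⟩
      · exact ⟨j, by omega, .inr ⟨rfl, by simp [h]⟩⟩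

/-! ### Connectivity, isolated toughness and suns -/

lemma card_le_numIsolated [Finite V] {I Y : Finset V} (hd : Disjoint I Y)
    (hN : ∀ u ∈ I, ∀ w, G.Adj u w → w ∈ Y) :
    I.card ≤ numIsolated (G.induce ((Y : Set V)ᶜ)) := by
  rw [numIsolated, ← Set.ncard_image_of_injective _ Subtype.val_injective,
    ← Set.ncard_coe_finset]
  refine Set.ncard_le_ncard (fun v hv => ?_) (Set.toFinite _)
  have hvY : v ∉ Y := Finset.disjoint_left.1 hd hv
  refine ⟨⟨v, by simpa using hvY⟩, ?_, rfl⟩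
  intro w hw
  exact w.2 (hN v hv w hw)

/-- Deleting `Y` isolates all of `I`; two vertices of `I` are not adjacent, so `G` is not complete.
-/
lemma isolatedToughness_le [Finite V] {I Y : Finset V} (h2 : 2 ≤ I.card) (hd : Disjoint I Y)
    (hN : ∀ u ∈ I, ∀ w, G.Adj u w → w ∈ Y) :
    isolatedToughness G ≤ (((Y.card : ℝ) / (I.card : ℝ) : ℝ) : EReal) := by
  have hne : G ≠ ⊤ := by
    rintro rfl
    obtain ⟨u, hu, w, hw, huw⟩ := Finset.one_lt_card.1 (show 1 < I.card by omega)
    exact Finset.disjoint_left.1 hd hw (hN u hu w huw)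
  have hle := card_le_numIsolated hd hN
  rw [isolatedToughness, if_neg hne]
  refine iInf₂_le_of_le (Y : Set V) (h2.trans hle) ?_
  rw [EReal.coe_le_coe_iff, Set.ncard_coe_finset]
  refine div_le_div_of_nonneg_left (by positivity) ?_ (by exact_mod_cast hle)
  exact_mod_cast (by omega : 0 < I.card)

lemma connectedOn_of_connected {A : Finset V} {s : Set V} (hs : ∀ v, v ∈ A ↔ v ∈ s)
    (h : (G.induce s).Connected) : ConnectedOn G A := by
  intro D hDA ⟨v, hv⟩ hc
  refine Finset.Subset.antisymm hDA fun w hw => ?_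
  obtain ⟨p⟩ := h.preconnected ⟨v, (hs v).1 (hDA hv)⟩ ⟨w, (hs w).1 hw⟩
  have key : ∀ a b : s, (G.induce s).Walk a b → a.1 ∈ D → b.1 ∈ D := by
    intro a b p
    induction p with
    | nil => exact id
    | cons h _ ih => exact fun ha => ih (hc _ ha _ ((hs _).2 (Subtype.mem _)) h)
  exact key _ _ p hv

lemma IsKConnected.connectedOn [Fintype V] {k : ℕ} (h : IsKConnected k G) {X : Finset V}
    (hX : X.card < k) : ConnectedOn G (Finset.univ \ X) :=
  connectedOn_of_connected (s := (X : Set V)ᶜ) (by simp)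
    (h.2 X (by rwa [Set.ncard_coe_finset]))

/-- If `v` had no neighbour outside `W` but `u`, deleting `W` and `u` would cut it off from the
vertices that remain. -/
lemma IsKConnected.hasTwoNeighbors [Fintype V] {n k : ℕ} (h : IsKConnected (n + k + 2) G)
    {W : Finset V} (hW : W.card = n) {v : V} (hv : v ∉ W) :
    HasTwoNeighbors G (Finset.univ \ W) v := by
  intro u
  -- The erasure keeps `v` in the graph when `u = v`.
  have hcard : (W ∪ ({u} : Finset V).erase v).card ≤ n + 1 := by
    refine (Finset.card_union_le _ _).trans ?_
    have := Finset.card_erase_le (s := ({u} : Finset V)) (a := v)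
    rw [Finset.card_singleton] at this
    omega
  have hconn := h.connectedOn (X := W ∪ ({u} : Finset V).erase v) (by omega)
  by_contra! hc
  have h1 := hconn {v} (by simp [hv]) (by simp) (by
    intro a ha w hw haw
    rw [Finset.mem_singleton] at ha
    subst ha
    simp only [Finset.mem_sdiff, Finset.mem_univ, true_and, Finset.mem_union, Finset.mem_erase,
      Finset.mem_singleton, not_or, not_and] at hw
    by_cases hwu : w = u
    · exact (hw.2 haw.ne' hwu).elim
    · exact (hc w (by simp [hw.1]) hwu haw).elim)
  have h2 := congrArg Finset.card h1
  rw [Finset.card_singleton, Finset.card_univ_sdiff] at h2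
  have h3 := h.1
  rw [Nat.card_eq_fintype_card] at h3
  omega

/-- A sun splits into an independent part `I` and a part `Y` containing all neighbours of `I`
within the sun; if it is not a single vertex, a given vertex can be kept out of `I`. -/
lemma IsSun.exists_parts {D : Finset V} (h : IsSun G D) (a : V) :
    ∃ I Y : Finset V, (∀ z, z ∈ D ↔ z ∈ I ∨ z ∈ Y) ∧ Disjoint I Y ∧ I.Nonempty ∧
      (∀ u ∈ I, ∀ w ∈ D, G.Adj u w → w ∈ Y) ∧
      (((∃ v, D = {v}) ∧ Y.card + 1 = I.card) ∨ ((¬ ∃ v, D = {v}) ∧ Y.card = I.card ∧ a ∉ I)) := by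
  by_cases hs : ∃ v, D = {v}
  · obtain ⟨v, rfl⟩ := hs
    refine ⟨{v}, ∅, by simp, by simp, by simp, ?_, .inl ⟨⟨v, rfl⟩, by simp⟩⟩
    intro u hu w hw ha
    rw [Finset.mem_singleton] at hu hw
    exact (ha.ne (hu.trans hw.symm)).elim
  obtain ⟨R, σ, hc⟩ := h.2.resolve_left hs
  have std : ∀ (R : Finset V) (σ : V → V), IsCorona G D R σ → (∀ r ∈ R, a ≠ σ r) →
      ∃ I Y : Finset V, (∀ z, z ∈ D ↔ z ∈ I ∨ z ∈ Y) ∧ Disjoint I Y ∧ I.Nonempty ∧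
      (∀ u ∈ I, ∀ w ∈ D, G.Adj u w → w ∈ Y) ∧
      (((∃ v, D = {v}) ∧ Y.card + 1 = I.card) ∨
        ((¬ ∃ v, D = {v}) ∧ Y.card = I.card ∧ a ∉ I)) := by
    intro R σ hc ha
    refine ⟨R.image σ, R, ?_, ?_, hc.nonempty.image σ, ?_, .inr ⟨hs, ?_, ?_⟩⟩
    · intro z; rw [hc.mem_iff]; simp [or_comm]
    · rw [Finset.disjoint_left]
      intro z hz
      obtain ⟨r, hr, rfl⟩ := Finset.mem_image.1 hz
      exact hc.notMem r hr
    · intro u hu w hw haw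
      obtain ⟨r, hr, rfl⟩ := Finset.mem_image.1 hu
      exact hc.leaf r hr w hw haw ▸ hr
    · rw [Finset.card_image_of_injOn fun r hr s hs => hc.inj r hr s hs]
    · intro h
      obtain ⟨r, hr, rfl⟩ := Finset.mem_image.1 h
      exact ha r hr rfl
  -- If `a` is the leaf at `r`, the two exchange roles; `r` is adjacent to no other leaf, so
  -- independence survives.
  by_cases ha : ∃ r ∈ R, a = σ r
  · obtain ⟨r, hr, rfl⟩ := ha
    have hnot : r ∉ (R.erase r).image σ := by
      intro h
      obtain ⟨t, ht, e⟩ := Finset.mem_image.1 h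
      exact hc.notMem t (Finset.mem_of_mem_erase ht) (e ▸ hr)
    have hnot' : σ r ∉ R.erase r := fun h => hc.notMem r hr (Finset.mem_of_mem_erase h)
    have i1 := hc.inj r hr
    have i2 := hc.notMem
    have e1 := hc.ne_leaf hr hr
    refine ⟨insert r ((R.erase r).image σ), insert (σ r) (R.erase r), ?_, ?_, by simp, ?_,
      .inr ⟨hs, ?_, ?_⟩⟩
    · intro z; rw [hc.mem_iff]; simp; grind
    · rw [Finset.disjoint_left]; intro z; simp; grind
    · intro u hu w hw haw
      rcases Finset.mem_insert.1 hu with rfl | hu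
      · rcases (hc.mem_iff w).1 hw with hwR | ⟨t, ht, rfl⟩
        · simp [hwR, haw.ne']
        · have := hc.leaf t ht u (hc.mem_base hr) haw.symm
          simp [this]
      · obtain ⟨t, ht, rfl⟩ := Finset.mem_image.1 hu
        have := hc.leaf t (Finset.mem_of_mem_erase ht) w hw haw
        subst this
        simp only [Finset.mem_insert]
        exact .inr ht
    · rw [Finset.card_insert_of_notMem hnot, Finset.card_insert_of_notMem hnot',
        Finset.card_image_of_injOn fun r hr s hs =>
          hc.inj r (Finset.mem_of_mem_erase hr) s (Finset.mem_of_mem_erase hs)]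
    · simp; grind
  · push Not at ha
    exact std R σ hc ha

-- A sun with an edge contributes equally to `I` and `Y`, a single vertex to `I` alone. This surplus
-- later pays for moving an end of the deleted edge.
open Classical in
lemma exists_independent_of_suns [Fintype V] (H : SimpleGraph V) (W S : Finset V) (a : V) :
    ∃ I Y : Finset V, Disjoint I Y ∧ (∀ u ∈ I, ∀ w, H.Adj u w → w ∈ Y) ∧
      (suns H ((Finset.univ \ W) \ S)).card ≤ I.card ∧
      Y.card + ((suns H ((Finset.univ \ W) \ S)).filter fun D => ∃ v, D = {v}).card
        ≤ W.card + S.card + I.card ∧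
      (∀ u ∈ I, ∃ D ∈ suns H ((Finset.univ \ W) \ S), u ∈ D) ∧
      ∀ D ∈ suns H ((Finset.univ \ W) \ S), a ∈ D → (¬ ∃ v, D = {v}) → a ∈ Y ∧ a ∉ I := by
  set 𝒟 := suns H ((Finset.univ \ W) \ S) with h𝒟
  have hex : ∀ D : Finset V, ∃ I Y : Finset V, IsSun H D → (∀ z, z ∈ D ↔ z ∈ I ∨ z ∈ Y) ∧
      Disjoint I Y ∧ I.Nonempty ∧ (∀ u ∈ I, ∀ w ∈ D, H.Adj u w → w ∈ Y) ∧
      (((∃ v, D = {v}) ∧ Y.card + 1 = I.card) ∨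
        ((¬ ∃ v, D = {v}) ∧ Y.card = I.card ∧ a ∉ I)) := by
    intro D
    by_cases hD : IsSun H D
    · obtain ⟨I, Y, h⟩ := hD.exists_parts a
      exact ⟨I, Y, fun _ => h⟩
    · exact ⟨∅, ∅, fun h => (hD h).elim⟩
  choose I Y hIY using hex
  have hp : ∀ D ∈ 𝒟, _ := fun D hD => hIY D (mem_suns.1 hD).2.1
  have hI : ∀ D ∈ 𝒟, I D ⊆ D := fun D hD z hz => ((hp D hD).1 z).2 (.inl hz)
  have hY : ∀ D ∈ 𝒟, Y D ⊆ D := fun D hD z hz => ((hp D hD).1 z).2 (.inr hz)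
  have hout : ∀ D ∈ 𝒟, ∀ z ∈ D, z ∉ W ∧ z ∉ S := fun D hD z hz => by
    have := (mem_suns.1 hD).1 hz
    simpa using this
  have hcardI : (𝒟.biUnion I).card = ∑ D ∈ 𝒟, (I D).card := by
    refine Finset.card_biUnion fun D hD E hE hne => ?_
    exact Finset.disjoint_of_subset_left (hI D hD)
      (Finset.disjoint_of_subset_right (hI E hE) (suns_disjoint hD hE hne))
  refine ⟨𝒟.biUnion I, W ∪ S ∪ 𝒟.biUnion Y, ?_, ?_, ?_, ?_, ?_, ?_⟩
  · rw [Finset.disjoint_left]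
    intro z hz hz'
    obtain ⟨D, hD, hzD⟩ := Finset.mem_biUnion.1 hz
    have h1 := hout D hD z (hI D hD hzD)
    simp only [Finset.mem_union, h1, false_or] at hz'
    obtain ⟨E, hE, hzE⟩ := Finset.mem_biUnion.1 hz'
    have := suns_eq_of_mem hD hE (hI D hD hzD) (hY E hE hzE)
    subst this
    exact Finset.disjoint_left.1 (hp D hD).2.1 hzD hzE
  · intro u hu w ha
    obtain ⟨D, hD, huD⟩ := Finset.mem_biUnion.1 hu
    by_cases hw : w ∈ W ∪ S
    · exact Finset.mem_union_left _ hw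
    · have hwD : w ∈ D := (mem_suns.1 hD).2.2 u (hI D hD huD) w (by simpa using hw) ha
      exact Finset.mem_union_right _ (Finset.mem_biUnion.2
        ⟨D, hD, (hp D hD).2.2.2.1 u huD w hwD ha⟩)
  · rw [hcardI, Finset.card_eq_sum_ones]
    exact Finset.sum_le_sum fun D hD => Finset.card_pos.2 (hp D hD).2.2.1
  · have h1 : (𝒟.biUnion Y).card + (𝒟.filter fun D => ∃ v, D = {v}).card
        ≤ ∑ D ∈ 𝒟, (I D).card := by
      rw [Finset.card_filter]
      refine (Nat.add_le_add_right Finset.card_biUnion_le _).trans ?_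
      rw [← Finset.sum_add_distrib]
      refine Finset.sum_le_sum fun D hD => ?_
      rcases (hp D hD).2.2.2.2 with ⟨h1, h2⟩ | ⟨h1, h2, -⟩
      · rw [if_pos h1, h2]
      · rw [if_neg h1, h2]; rfl
    have h2 := Finset.card_union_le (W ∪ S) (𝒟.biUnion Y)
    have h3 := Finset.card_union_le W S
    omega
  · intro u hu
    obtain ⟨D, hD, huD⟩ := Finset.mem_biUnion.1 hu
    exact ⟨D, hD, hI D hD huD⟩
  · intro D hD haD hns
    have haI : a ∉ I D := by
      rcases (hp D hD).2.2.2.2 with ⟨h1, -⟩ | ⟨-, -, h2⟩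
      · exact (hns h1).elim
      · exact h2
    refine ⟨Finset.mem_union_right _ (Finset.mem_biUnion.2
      ⟨D, hD, (((hp D hD).1 a).1 haD).resolve_left haI⟩), fun h => ?_⟩
    obtain ⟨E, hE, haE⟩ := Finset.mem_biUnion.1 h
    have := suns_eq_of_mem hD hE haD (hI E hE haE)
    subst this
    exact haI haE

/-- `|Y|/|I| ≤ 1 + (n + x)/(2x) = 3/2 + n/(2x)`, which does not increase with `x`; at `x = r + 2` it
is the stated bound. -/
lemma not_lt_isolatedToughness [Finite V] {n r x : ℕ} (hx : r + 2 ≤ x) {I Y : Finset V}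
    (hI : 2 * x ≤ I.card) (hY : Y.card ≤ n + x + I.card) (hd : Disjoint I Y)
    (hN : ∀ u ∈ I, ∀ w, G.Adj u w → w ∈ Y) :
    ¬ ((((n : ℝ) + 3 * ((r : ℝ) + 2)) / (2 * ((r : ℝ) + 2)) : ℝ) : EReal)
        < isolatedToughness G := by
  rw [not_lt]
  refine (isolatedToughness_le (by omega) hd hN).trans ?_
  rw [EReal.coe_le_coe_iff]
  have h1 : (2 : ℝ) * x ≤ I.card := by exact_mod_cast hI
  have h2 : (Y.card : ℝ) ≤ n + x + I.card := by exact_mod_cast hY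
  have h3 : (r : ℝ) + 2 ≤ x := by exact_mod_cast hx
  have hr : (0 : ℝ) ≤ r := by positivity
  have hn : (0 : ℝ) ≤ n := by positivity
  have hIpos : (0 : ℝ) < I.card := by linarith
  rw [div_le_div_iff₀ hIpos (by linarith)]
  have h4 : (Y.card : ℝ) * (2 * (r + 2)) ≤ (n + x + I.card) * (2 * (r + 2)) :=
    mul_le_mul_of_nonneg_right h2 (by linarith)
  have h5 : (n : ℝ) * (2 * (r + 2)) ≤ n * I.card :=
    mul_le_mul_of_nonneg_left (by linarith) hn
  have h6 : 2 * (x : ℝ) * (r + 2) ≤ I.card * (r + 2) :=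
    mul_le_mul_of_nonneg_right h1 (by linarith)
  nlinarith

/-- A large set violating the sun condition for `G` without an edge and without `n` vertices bounds
the isolated toughness of `G`. -/
lemma not_lt_isolatedToughness_of_suns [Fintype V] {n r : ℕ} {W S : Finset V} {a b : V}
    (hab : a ≠ b) (hW : W.card = n) (hx : r + 2 ≤ S.card)
    (hlt : 2 * S.card < (suns (G.deleteEdges {s(a, b)}) ((Finset.univ \ W) \ S)).card) :
    ¬ ((((n : ℝ) + 3 * ((r : ℝ) + 2)) / (2 * ((r : ℝ) + 2)) : ℝ) : EReal)
        < isolatedToughness G := by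
  classical
  -- Restoring `ab` may spoil the independence of `I`. Up to symmetry, `a` lies in a larger sun and
  -- can be put into `Y`, or `{a}` is a sun and `b` lies in no larger one, or neither end lies in a
  -- sun.
  wlog hwl : ((∃ D ∈ suns (G.deleteEdges {s(a, b)}) ((Finset.univ \ W) \ S), a ∈ D ∧
      ¬ ∃ v, D = {v}) ∨
      ((¬ ∃ D ∈ suns (G.deleteEdges {s(a, b)}) ((Finset.univ \ W) \ S), b ∈ D ∧
        ¬ ∃ v, D = {v}) ∧ {a} ∈ suns (G.deleteEdges {s(a, b)}) ((Finset.univ \ W) \ S)) ∨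
      ((¬ ∃ D ∈ suns (G.deleteEdges {s(a, b)}) ((Finset.univ \ W) \ S), a ∈ D) ∧
        ¬ ∃ D ∈ suns (G.deleteEdges {s(a, b)}) ((Finset.univ \ W) \ S), b ∈ D)) generalizing a b
  · refine this (a := b) (b := a) hab.symm (by rwa [Sym2.eq_swap]) ?_
    rw [Sym2.eq_swap]
    have hsing : ∀ (c : V) (D : Finset V), c ∈ D → (∃ v, D = {v}) → D = {c} := by
      rintro c D hc ⟨v, rfl⟩
      rw [Finset.mem_singleton.1 hc]
    by_contra hcon
    push Not at hwl hcon
    have key : ∀ c, (∀ D ∈ suns (G.deleteEdges {s(a, b)}) ((Finset.univ \ W) \ S), c ∈ D →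
        ∃ v, D = {v}) → {c} ∉ suns (G.deleteEdges {s(a, b)}) ((Finset.univ \ W) \ S) →
        ∀ D ∈ suns (G.deleteEdges {s(a, b)}) ((Finset.univ \ W) \ S), c ∉ D := by
      intro c hc hcs D hD hcD
      exact hcs (hsing c D hcD (hc D hD hcD) ▸ hD)
    have ha := key a hwl.1 (hwl.2.1 hcon.1)
    have hb := key b hcon.1 (hcon.2.1 hwl.1)
    obtain ⟨D, hD, hbD⟩ := hwl.2.2 ha
    exact hb D hD hbD
  set H := G.deleteEdges {s(a, b)} with hH
  set 𝒟 := suns H ((Finset.univ \ W) \ S) with h𝒟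
  have hHG : ∀ u w, G.Adj u w → ¬ H.Adj u w → (u = a ∧ w = b) ∨ (u = b ∧ w = a) := by
    intro u w h1 h2
    simp only [hH, deleteEdges_adj, Set.mem_singleton_iff, Sym2.eq_iff, not_and, not_not] at h2
    exact h2 h1
  obtain ⟨I, Y, hd, hN, hcI, hcY, hID, haY⟩ := exists_independent_of_suns H W S a
  rw [← h𝒟] at hcI hcY hID haY
  rcases hwl with ⟨D, hD, haD, hns⟩ | ⟨hb, ha⟩ | ⟨ha, hb⟩
  · obtain ⟨h1, h2⟩ := haY D hD haD hns
    refine not_lt_isolatedToughness hx (I := I) (Y := Y) (by omega) (by omega) hd ?_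
    intro u hu w huw
    by_cases hadj : H.Adj u w
    · exact hN u hu w hadj
    · rcases hHG u w huw hadj with ⟨rfl, -⟩ | ⟨-, rfl⟩
      · exact (h2 hu).elim
      · exact h1
  · have hd' := Finset.disjoint_left.1 hd
    have hbI : b ∈ I → {b} ∈ 𝒟 := by
      intro h
      obtain ⟨D, hD, hbD⟩ := hID b h
      have : ∃ v, D = {v} := by
        by_contra hc
        exact hb ⟨D, hD, hbD, hc⟩
      obtain ⟨v, rfl⟩ := this
      rwa [Finset.mem_singleton.1 hbD]
    -- Moving `b` from `I` to `Y` costs two units, paid by the single suns `{a}` and `{b}`; if `b ∉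
    -- I` the cost is one, paid by `{a}`. As there are more than `2|S|` suns, `I` stays large
    -- enough.
    have hcard : (insert b Y).card ≤ n + S.card + (I.erase b).card ∧
        2 * S.card ≤ (I.erase b).card := by
      have h1 := Finset.card_insert_le b Y
      by_cases h : b ∈ I
      · have h2 : ({{a}, {b}} : Finset (Finset V)) ⊆ 𝒟.filter fun D => ∃ v, D = {v} := by
          intro D hD
          simp only [Finset.mem_insert, Finset.mem_singleton] at hD
          rw [Finset.mem_filter]
          rcases hD with rfl | rfl
          · exact ⟨ha, a, rfl⟩
          · exact ⟨hbI h, b, rfl⟩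
        have h3 := Finset.card_le_card h2
        rw [Finset.card_pair (by simpa using hab)] at h3
        have h4 := Finset.card_erase_add_one h
        omega
      · have h2 : ({{a}} : Finset (Finset V)) ⊆ 𝒟.filter fun D => ∃ v, D = {v} := by
          intro D hD
          rw [Finset.mem_singleton] at hD
          subst hD
          exact Finset.mem_filter.2 ⟨ha, a, rfl⟩
        have h3 := Finset.card_le_card h2
        rw [Finset.card_singleton] at h3
        rw [Finset.erase_eq_of_notMem h]
        omega
    refine not_lt_isolatedToughness hx hcard.2 hcard.1 ?_ ?_
    · rw [Finset.disjoint_left]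
      intro z hz hz'
      rw [Finset.mem_erase] at hz
      rcases Finset.mem_insert.1 hz' with rfl | h
      · exact hz.1 rfl
      · exact hd' hz.2 h
    · intro u hu w huw
      rw [Finset.mem_erase] at hu
      rw [Finset.mem_insert]
      by_cases hadj : H.Adj u w
      · exact .inr (hN u hu.2 w hadj)
      · rcases hHG u w huw hadj with ⟨-, rfl⟩ | ⟨rfl, -⟩
        · exact .inl rfl
        · exact (hu.1 rfl).elim
  · refine not_lt_isolatedToughness hx (I := I) (Y := Y) (by omega) (by omega) hd ?_
    intro u hu w huw
    by_cases hadj : H.Adj u w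
    · exact hN u hu w hadj
    · rcases hHG u w huw hadj with ⟨rfl, -⟩ | ⟨rfl, -⟩
      · exact (ha (hID u hu)).elim
      · exact (hb (hID u hu)).elim

/-- In a sufficiently connected graph only large sets can violate the sun condition. -/
lemma IsKConnected.le_card_of_suns [Fintype V] {n r : ℕ} (hG : IsKConnected (n + r + 2) G)
    {W S : Finset V} {a b : V} (ha : a ∉ W) (hb : b ∉ W) (hW : W.card = n)
    (hS : S ⊆ Finset.univ \ W)
    (hlt : 2 * S.card < (suns (G.deleteEdges {s(a, b)}) ((Finset.univ \ W) \ S)).card) :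
    r + 2 ≤ S.card := by
  classical
  by_contra! hx
  set H := G.deleteEdges {s(a, b)} with hH
  have hHG : ∀ u w, G.Adj u w → ¬ H.Adj u w → (u = a ∧ w = b) ∨ (u = b ∧ w = a) := by
    intro u w h1 h2
    simp only [hH, deleteEdges_adj, Set.mem_singleton_iff, Sym2.eq_iff, not_and, not_not] at h2
    exact h2 h1
  have hconn : ConnectedOn G ((Finset.univ \ W) \ S) := by
    have h1 := Finset.card_union_le W S
    have h2 : (Finset.univ \ W) \ S = Finset.univ \ (W ∪ S) := by ext; simp
    rw [h2]
    exact hG.connectedOn (by omega)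
  have hfull : ∀ D ∈ suns H ((Finset.univ \ W) \ S), a ∉ D → b ∉ D →
      D = (Finset.univ \ W) \ S := by
    intro D hD haD hbD
    obtain ⟨h1, h2, h3⟩ := mem_suns.1 hD
    refine hconn D h1 h2.nonempty fun u hu w hw huw => ?_
    by_cases hadj : H.Adj u w
    · exact h3 u hu w hw hadj
    · rcases hHG u w huw hadj with ⟨rfl, -⟩ | ⟨rfl, -⟩
      · exact (haD hu).elim
      · exact (hbD hu).elim
  -- There are at least three suns, so one contains neither `a` nor `b`. It is closed in the
  -- connected graph `G - W - S`, hence all of it, and leaves no room for the others.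
  by_cases hne : S.Nonempty
  · have hSc := Finset.card_pos.2 hne
    have hone : ∀ c : V, ((suns H ((Finset.univ \ W) \ S)).filter fun D => c ∈ D).card ≤ 1 := by
      intro c
      refine Finset.card_le_one.2 fun E hE E' hE' => ?_
      rw [Finset.mem_filter] at hE hE'
      exact suns_eq_of_mem hE.1 hE'.1 hE.2 hE'.2
    obtain ⟨D, hD, haD, hbD⟩ : ∃ D ∈ suns H ((Finset.univ \ W) \ S), a ∉ D ∧ b ∉ D := by
      by_contra! hc
      have h1 : suns H ((Finset.univ \ W) \ S) ⊆
          (suns H ((Finset.univ \ W) \ S)).filter (fun D => a ∈ D) ∪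
          (suns H ((Finset.univ \ W) \ S)).filter fun D => b ∈ D := by
        intro D hD
        rw [Finset.mem_union, Finset.mem_filter, Finset.mem_filter]
        by_cases h : a ∈ D
        · exact .inl ⟨hD, h⟩
        · exact .inr ⟨hD, hc D hD h⟩
      have h2 := (Finset.card_le_card h1).trans (Finset.card_union_le _ _)
      have h3 := hone a
      have h4 := hone b
      omega
    obtain ⟨E, hE, hED⟩ := Finset.exists_mem_ne
      (show 1 < (suns H ((Finset.univ \ W) \ S)).card by omega) D
    obtain ⟨z, hz⟩ := (mem_suns.1 hE).2.1.nonempty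
    have := hfull D hD haD hbD
    exact hED (suns_eq_of_mem hE hD hz (this ▸ (mem_suns.1 hE).1 hz))
  · rw [Finset.not_nonempty_iff_eq_empty] at hne
    subst hne
    simp only [Finset.sdiff_empty, Finset.card_empty, mul_zero] at hlt
    obtain ⟨D, hD⟩ := Finset.card_pos.1 hlt
    obtain ⟨h1, h2, h3⟩ := mem_suns.1 hD
    have htwo : ∀ v ∈ D, HasTwoNeighbors G (Finset.univ \ W) v := fun v hv =>
      hG.hasTwoNeighbors hW (Finset.mem_sdiff.1 (h1 hv)).2
    -- Every vertex has two neighbours in `G - W`, so one with at most one neighbour in `D` has lost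
    -- the edge `ab`.
    have hleaf : ∀ v ∈ D, ∀ u, (∀ w ∈ D, H.Adj v w → w = u) → v = a ∨ v = b := by
      intro v hv u hu
      obtain ⟨w, hw, hwu, hvw⟩ := htwo v hv u
      by_cases hadj : H.Adj v w
      · exact (hwu (hu w (h3 v hv w hw hadj) hadj)).elim
      · rcases hHG v w hvw hadj with h | h
        · exact .inl h.1
        · exact .inr h.1
    rcases h2.2 with ⟨v, rfl⟩ | ⟨R, σ, hc⟩
    · obtain ⟨w, hw, -, hvw⟩ := htwo v (by simp) v
      obtain ⟨w', hw', hne, hvw'⟩ := htwo v (by simp) w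
      have hno : ∀ w ∈ Finset.univ \ W, ¬ H.Adj v w := by
        intro w hw h
        have := h3 v (by simp) w hw h
        rw [Finset.mem_singleton] at this
        exact h.ne this.symm
      have e1 := hHG v w hvw (hno w hw)
      have e2 := hHG v w' hvw' (hno w' hw')
      grind
    · have hσ : ∀ r ∈ R, σ r = a ∨ σ r = b := fun r hr =>
        hleaf (σ r) (hc.mem_leaf hr) r fun w hw h => hc.leaf r hr w hw h
      obtain ⟨r, hr⟩ := hc.nonempty
      by_cases hR : R = {r}
      · have hsw := hc.swap hR
        have e1 := hleaf r (hc.mem_base hr) (σ r) fun w hw h => hsw.leaf (σ r) (by simp) w hw h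
        have e2 := hσ r hr
        have e3 := hc.adj r hr
        have e4 : ¬ H.Adj a b := by simp [hH]
        have e5 : ¬ H.Adj b a := by simp [hH]
        have e6 := e3.ne
        grind
      -- A base with more than one vertex has at least three, and their leaves cannot all be `a` or
      -- `b`.
      · obtain ⟨t, ht, htr⟩ : ∃ t ∈ R, t ≠ r := by
          by_contra! h
          exact hR (Finset.eq_singleton_iff_unique_mem.2 ⟨hr, h⟩)
        obtain ⟨s, -, hs, hts, hsr, -⟩ := hc.exists_mate hr ht htr
        have e1 := hσ r hr
        have e2 := hσ t ht
        have e3 := hσ s hs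
        have e4 := hc.inj r hr t ht
        have e5 := hc.inj r hr s hs
        have e6 := hc.inj t ht s hs
        have e7 := hts.ne
        grind

theorem isFactorCriticalAvoidable_of_isolatedToughness {U : Type*} [Finite U]
    {G : SimpleGraph U} {n r : ℕ}
    (hG : IsKConnected (n + r + 2) G)
    (hI : ((((n : ℝ) + 3 * ((r : ℝ) + 2)) / (2 * ((r : ℝ) + 2)) : ℝ) : EReal)
      < isolatedToughness G) : IsFactorCriticalAvoidable 3 n G := by
  classical
  have := Fintype.ofFinite U
  intro W hW e he
  induction e using Sym2.ind with
  | _ a b =>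
  have hab : G.Adj a.1 b.1 := he
  have haW : a.1 ∉ W := fun h => a.2 (Finset.mem_coe.2 h)
  have hbW : b.1 ∉ W := fun h => b.2 (Finset.mem_coe.2 h)
  by_cases hc : SunCondition (G.deleteEdges {s(a.1, b.1)}) (Finset.univ \ W)
  · obtain ⟨F, hF⟩ := (pathCoverable_of_sunCondition _ _ hc).exists_isPathFactor
      (s := (W : Set U)ᶜ) (by simp)
    refine ⟨F, ⟨fun u w h => ?_, hF.2⟩, fun h => ?_⟩
    · exact G.deleteEdges_le _ (hF.1 h)
    · have h1 : (G.deleteEdges {s(a.1, b.1)}).Adj a.1 b.1 := hF.1 h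
      simp at h1
  · simp only [SunCondition, not_forall, not_le] at hc
    obtain ⟨S, hS, hlt⟩ := hc
    exact (not_lt_isolatedToughness_of_suns hab.ne hW
      (hG.le_card_of_suns haW hbW hW hS hlt) hlt hI).elim


/-! ### Sharpness: the graphs `K_a + m K₂` -/

lemma pathGraph_eq_of_adj {m : ℕ} {i x y z : Fin m} (hx : (pathGraph m).Adj i x)
    (hy : (pathGraph m).Adj i y) (hz : (pathGraph m).Adj i z) : x = y ∨ x = z ∨ y = z := by
  simp only [pathGraph_adj] at hx hy hz
  simp only [Fin.ext_iff]
  omega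

lemma IsPathFactor.eq_of_adj {U : Type*} {k : ℕ} {G F : SimpleGraph U} (h : IsPathFactor k G F)
    {v x y z : U} (hx : F.Adj v x) (hy : F.Adj v y) (hz : F.Adj v z) :
    x = y ∨ x = z ∨ y = z := by
  obtain ⟨m, -, -, ⟨φ⟩⟩ := h.2 (F.connectedComponentMk v)
  have hmem : ∀ w, F.Adj v w → w ∈ (F.connectedComponentMk v).supp := fun w hw =>
    ConnectedComponent.sound hw.symm.reachable
  have hv : v ∈ (F.connectedComponentMk v).supp := rfl
  have hadj : ∀ w (hw : F.Adj v w), (pathGraph m).Adj (φ ⟨v, hv⟩) (φ ⟨w, hmem w hw⟩) :=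
    fun w hw => φ.map_adj_iff.2 hw
  simpa using pathGraph_eq_of_adj (hadj x hx) (hadj y hy) (hadj z hz)

/-- A component inside `{x, y}` would have fewer than three vertices. The case `x = y` serves for
single vertices. -/
lemma IsPathFactor.exists_adj_ne {U : Type*} {G F : SimpleGraph U} (h : IsPathFactor 3 G F)
    (x y : U) : ∃ z, z ≠ x ∧ z ≠ y ∧ (F.Adj x z ∨ F.Adj y z) := by
  classical
  by_contra! hc
  obtain ⟨m, -, hm, ⟨φ⟩⟩ := h.2 (F.connectedComponentMk x)
  have hclosed : ∀ u v, F.Reachable u v → (u = x ∨ u = y) → (v = x ∨ v = y) := by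
    rintro u v ⟨p⟩
    induction p with
    | nil => exact id
    | cons huv _ ih =>
      intro hu
      refine ih ?_
      by_contra! hv
      have := hc _ hv.1 hv.2
      rcases hu with rfl | rfl
      · exact this.1 huv
      · exact this.2 huv
  have hsub : (F.connectedComponentMk x).supp ⊆ (({x, y} : Finset U) : Set U) := by
    intro v hv
    have hv' : F.connectedComponentMk v = F.connectedComponentMk x := hv
    simpa using hclosed x v (ConnectedComponent.exact hv').symm (.inl rfl)
  have h1 := Set.ncard_le_ncard hsub
  have h2 : (F.connectedComponentMk x).supp.ncard = m := by
    have h3 := Nat.card_congr φ.toEquiv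
    rw [Nat.card_fin] at h3
    exact h3
  rw [h2, Set.ncard_coe_finset] at h1
  have := Finset.card_le_two (a := x) (b := y)
  omega

@[simp]
lemma completeJoinK2_adj_inl_inl {a m : ℕ} {u v : Fin a} :
    (completeJoinK2 a m).Adj (.inl u) (.inl v) ↔ u ≠ v := Iff.rfl

@[simp]
lemma completeJoinK2_adj_inl_inr {a m : ℕ} {u : Fin a} {p : Fin m × Fin 2} :
    (completeJoinK2 a m).Adj (.inl u) (.inr p) := trivial

@[simp]
lemma completeJoinK2_adj_inr_inr {a m : ℕ} {p q : Fin m × Fin 2} :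
    (completeJoinK2 a m).Adj (.inr p) (.inr q) ↔ p.1 = q.1 ∧ p.2 ≠ q.2 := by
  change (copiesK2 m).Adj p q ↔ _
  simp [copiesK2, boxProd_adj, and_comm]

lemma completeJoinK2_adj_inl {a m : ℕ} {u : Fin a} {v : Fin a ⊕ Fin m × Fin 2}
    (h : v ≠ .inl u) : (completeJoinK2 a m).Adj (.inl u) v := by
  cases v with
  | inl v => simpa [eq_comm] using h
  | inr p => simp

lemma isKConnected_completeJoinK2 {a m : ℕ} (hm : 1 ≤ m) :
    IsKConnected a (completeJoinK2 a m) := by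
  refine ⟨by simp; omega, fun X hX => ?_⟩
  obtain ⟨u, hu⟩ : ∃ u : Fin a, Sum.inl u ∉ X := by
    by_contra! hc
    have h1 : Set.range (Sum.inl : Fin a → Fin a ⊕ Fin m × Fin 2) ⊆ X := by
      rintro _ ⟨u, rfl⟩
      exact hc u
    have h2 := Set.ncard_le_ncard h1
    rw [← Set.image_univ, Set.ncard_image_of_injective _ Sum.inl_injective,
      Set.ncard_univ, Nat.card_fin] at h2
    omega
  refine connected_iff_exists_forall_reachable _ |>.2 ⟨⟨_, hu⟩, fun w => ?_⟩
  by_cases hw : w.1 = .inl u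
  · rw [show w = ⟨_, hu⟩ from Subtype.ext hw]
  · exact Adj.reachable (completeJoinK2_adj_inl hw :
      (completeJoinK2 a m).Adj (.inl u) w.1)

/-- A surviving clique vertex is adjacent to everything else, so two isolated vertices force the
whole clique into `X`. Each isolated vertex then also has its `K₂`-partner in `X`. -/
lemma completeJoinK2_isolated {a m : ℕ} {X : Set (Fin a ⊕ Fin m × Fin 2)}
    (h : 2 ≤ numIsolated ((completeJoinK2 a m).induce Xᶜ)) :
    numIsolated ((completeJoinK2 a m).induce Xᶜ) ≤ m ∧
      a + numIsolated ((completeJoinK2 a m).induce Xᶜ) ≤ X.ncard := by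
  classical
  set J : Set (Fin a ⊕ Fin m × Fin 2) :=
    Subtype.val '' {v | ((completeJoinK2 a m).induce Xᶜ).IsIsolated v} with hJ
  have hcard : J.ncard = numIsolated ((completeJoinK2 a m).induce Xᶜ) :=
    Set.ncard_image_of_injective _ Subtype.val_injective
  have hJX : ∀ v ∈ J, v ∉ X := by
    rintro _ ⟨v, -, rfl⟩
    exact v.2
  have hJadj : ∀ v ∈ J, ∀ w, (completeJoinK2 a m).Adj v w → w ∈ X := by
    rintro _ ⟨v, hv, rfl⟩ w hvw
    by_contra hw
    exact hv ⟨w, hw⟩ hvw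
  rw [← hcard] at h ⊢
  have hinl : ∀ u : Fin a, Sum.inl u ∈ X := by
    intro u
    obtain ⟨v, hv, hvu⟩ := Set.exists_ne_of_one_lt_ncard (by omega : 1 < J.ncard) (Sum.inl u)
    exact hJadj v hv _ (completeJoinK2_adj_inl hvu).symm
  have hinr : ∀ v ∈ J, ∃ p, v = Sum.inr p := by
    intro v hv
    cases v with
    | inl u => exact (hJX _ hv (hinl u)).elim
    | inr p => exact ⟨p, rfl⟩
  let T : Set (Fin m) := {j | ∃ b, Sum.inr (j, b) ∈ J}
  choose b hb using fun j : T => j.2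
  have hJT : J = Set.range fun j : T => (Sum.inr (j.1, b j) : Fin a ⊕ Fin m × Fin 2) := by
    ext v
    constructor
    · intro hv
      obtain ⟨⟨j, c⟩, rfl⟩ := hinr v hv
      refine ⟨⟨j, c, hv⟩, ?_⟩
      by_contra hne
      refine hJX _ (hb ⟨j, c, hv⟩) (hJadj _ hv _ ?_)
      simp only [completeJoinK2_adj_inr_inr, true_and]
      intro hc
      exact hne (by simp [← hc])
    · rintro ⟨j, rfl⟩
      exact hb j
  have hJcard : J.ncard = T.ncard := by
    rw [hJT, ← Set.image_univ, Set.ncard_image_of_injective _ (by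
      intro i j hij
      simp only [Sum.inr.injEq, Prod.mk.injEq] at hij
      exact Subtype.ext hij.1), Set.ncard_univ]
    rfl
  refine ⟨?_, ?_⟩
  · rw [hJcard]
    simpa using Set.ncard_le_card T
  -- In `Fin 2`, `b j + 1` is the other vertex of the copy `j`.
  · let f : Fin a ⊕ T → Fin a ⊕ Fin m × Fin 2 :=
      Sum.map id fun j => (j.1, b j + 1)
    have hf : Function.Injective f := by
      refine Function.Injective.sumMap Function.injective_id fun i j hij => ?_
      simp only [Prod.mk.injEq] at hij
      exact Subtype.ext hij.1
    have hfX : Set.range f ⊆ X := by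
      rintro _ ⟨u | j, rfl⟩
      · exact hinl u
      · refine hJadj _ (hb j) _ ?_
        simp only [f, Sum.map_inr, completeJoinK2_adj_inr_inr, true_and]
        generalize b j = c
        revert c
        decide
    have h1 := Set.ncard_le_ncard hfX
    rw [← Set.image_univ, Set.ncard_image_of_injective _ hf, Set.ncard_univ, Nat.card_sum,
      Nat.card_fin] at h1
    rw [hJcard]
    exact h1

/-- With `i` isolated vertices the ratio is at least `(a + i)/i`, which is least at `i = m`;
deleting the clique and one vertex of each `K₂` attains it. -/
lemma isolatedToughness_completeJoinK2 {a m : ℕ} (hm : 2 ≤ m) :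
    isolatedToughness (completeJoinK2 a m) = ((((a : ℝ) + m) / m : ℝ) : EReal) := by
  have hm0 : (0 : ℝ) < m := by exact_mod_cast (by omega : 0 < m)
  refine le_antisymm ?_ ?_
  · let I : Finset (Fin a ⊕ Fin m × Fin 2) :=
      (∅ : Finset (Fin a)).disjSum (Finset.univ ×ˢ {0})
    let Y : Finset (Fin a ⊕ Fin m × Fin 2) :=
      (Finset.univ : Finset (Fin a)).disjSum (Finset.univ ×ˢ {1})
    have hI : I.card = m := by simp [I]
    have hY : Y.card = a + m := by simp [Y]
    have h := isolatedToughness_le (G := completeJoinK2 a m) (I := I) (Y := Y) (by omega)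
      (by
        rw [Finset.disjoint_left]
        rintro (u | ⟨j, b⟩) h1 h2
        · simp [I] at h1
        · simp [I] at h1
          simp [Y] at h2
          omega)
      (by
        rintro (u | ⟨j, b⟩) h1 (w | ⟨k, c⟩) h2
        · simp [I] at h1
        · simp [I] at h1
        · simp [Y]
        · simp [I] at h1
          subst h1
          simp only [completeJoinK2_adj_inr_inr] at h2
          simp only [Y, Finset.inr_mem_disjSum, Finset.mem_product, Finset.mem_univ,
            Finset.mem_singleton, true_and]
          omega)
    rwa [hI, hY, Nat.cast_add] at h
  · unfold isolatedToughness
    split_ifs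
    · exact le_top
    refine le_iInf₂ fun X hX => ?_
    obtain ⟨h1, h2⟩ := completeJoinK2_isolated hX
    set i := numIsolated ((completeJoinK2 a m).induce Xᶜ)
    have hi0 : (0 : ℝ) < i := by exact_mod_cast (by omega : 0 < i)
    have h1' : (i : ℝ) ≤ m := by exact_mod_cast h1
    have h2' : (a : ℝ) + i ≤ X.ncard := by exact_mod_cast h2
    rw [EReal.coe_le_coe_iff, div_le_div_iff₀ hm0 hi0]
    nlinarith [(Nat.cast_nonneg a : (0 : ℝ) ≤ a)]

/-- Delete `n` clique vertices and forbid one `K₂`. Its two vertices and the other `2s - 1` copies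
are `2s + 1` pieces too small for a path of order three, so each sends an edge to one of the `s`
clique vertices left; some clique vertex then has degree at least three. -/
lemma not_isFactorCriticalAvoidable_completeJoinK2 {a m n s : ℕ} (ha : a = n + s)
    (hm : m = 2 * s) (hs : 1 ≤ s) : ¬ IsFactorCriticalAvoidable 3 n (completeJoinK2 a m) := by
  classical
  intro h
  obtain ⟨W, -, hW⟩ := Finset.exists_subset_card_eq
    (show n ≤ (Finset.univ : Finset (Fin a)).card by simp; omega)
  set W' : Finset (Fin a ⊕ Fin m × Fin 2) := W.map ⟨Sum.inl, Sum.inl_injective⟩ with hW'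
  have hinr : ∀ p, (Sum.inr p : Fin a ⊕ Fin m × Fin 2) ∈ ((W' : Set _)ᶜ) := by
    intro p
    simp [hW']
  let ι : Fin m × Fin 2 → ↥((W' : Set (Fin a ⊕ Fin m × Fin 2))ᶜ) := fun p => ⟨_, hinr p⟩
  let j₀ : Fin m := ⟨0, by omega⟩
  obtain ⟨F, hF, he⟩ := h W' (by rw [hW', Finset.card_map, hW]) s(ι (j₀, 0), ι (j₀, 1))
    (show (completeJoinK2 a m).Adj (.inr (j₀, 0)) (.inr (j₀, 1)) by simp)
  have hFadj : ∀ p q, F.Adj (ι p) (ι q) → p.1 = q.1 ∧ p.2 ≠ q.2 := by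
    intro p q hpq
    have h1 : (completeJoinK2 a m).Adj (.inr p) (.inr q) := hF.1 hpq
    simpa using h1
  have h01 : ¬ F.Adj (ι (j₀, 0)) (ι (j₀, 1)) := he
  -- The pieces are indexed by `Option (Fin m)`: `none` is the vertex `(j₀, 1)`, `some j₀` is `(j₀,
  -- 0)`, and any other `some j` is the copy `j`.
  have hunit : ∀ o : Option (Fin m), ∃ p : Fin m × Fin 2, ∃ u : Fin a, ∃ hu : u ∈ Wᶜ,
      F.Adj ⟨.inl u, by simpa [hW'] using hu⟩ (ι p) ∧
      o = if p = (j₀, 1) then none else some p.1 := by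
    intro o
    have hout : ∀ p z, F.Adj (ι p) z → (∃ u : Fin a, ∃ hu : u ∈ Wᶜ,
        F.Adj ⟨.inl u, by simpa [hW'] using hu⟩ (ι p)) ∨ ∃ q, z = ι q := by
      rintro p ⟨u | q, hz⟩ hadj
      · exact .inl ⟨u, by simpa [hW'] using hz, hadj.symm⟩
      · exact .inr ⟨q, rfl⟩
    have hsing : ∀ c, ∃ u : Fin a, ∃ hu : u ∈ Wᶜ,
        F.Adj ⟨.inl u, by simpa [hW'] using hu⟩ (ι (j₀, c)) := by
      intro c
      obtain ⟨z, -, -, hz⟩ := hF.exists_adj_ne (ι (j₀, c)) (ι (j₀, c))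
      rw [or_self] at hz
      rcases hout _ _ hz with h1 | ⟨⟨k, d⟩, rfl⟩
      · exact h1
      · obtain ⟨h2, h3⟩ := hFadj _ _ hz
        simp only at h2 h3
        subst h2
        fin_cases c <;> fin_cases d
        · exact (h3 rfl).elim
        · exact (h01 hz).elim
        · exact (h01 hz.symm).elim
        · exact (h3 rfl).elim
    cases o with
    | none =>
      obtain ⟨u, hu, h1⟩ := hsing 1
      exact ⟨_, u, hu, h1, by simp⟩
    | some j =>
      by_cases hj : j = j₀
      · subst hj
        obtain ⟨u, hu, h1⟩ := hsing 0
        exact ⟨_, u, hu, h1, by simp⟩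
      · obtain ⟨z, hz0, hz1, hz⟩ := hF.exists_adj_ne (ι (j, 0)) (ι (j, 1))
        obtain ⟨c, hz⟩ : ∃ c, F.Adj (ι (j, c)) z := by
          rcases hz with hz | hz
          exacts [⟨_, hz⟩, ⟨_, hz⟩]
        rcases hout _ _ hz with ⟨u, hu, h1⟩ | ⟨⟨k, d⟩, rfl⟩
        · exact ⟨_, u, hu, h1, by simp [hj]⟩
        · obtain ⟨h2, -⟩ := hFadj _ _ hz
          simp only at h2
          subst h2
          fin_cases d
          · exact (hz0 rfl).elim
          · exact (hz1 rfl).elim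
  choose p u hu hadj hp using hunit
  have hpinj : ∀ o o', ι (p o) = ι (p o') → o = o' := by
    intro o o' hoo
    have h1 : p o = p o' := by simpa [ι] using hoo
    rw [hp o, hp o', h1]
  have hcard : (Wᶜ).card * 2 < (Finset.univ : Finset (Option (Fin m))).card := by
    rw [Finset.card_compl, hW]
    simp
    omega
  obtain ⟨v, -, hv⟩ := Finset.exists_lt_card_fiber_of_mul_lt_card_of_maps_to
    (f := u) (fun o _ => hu o) hcard
  obtain ⟨x, y, z, hx, hy, hz, hxy, hxz, hyz⟩ := Finset.two_lt_card_iff.1 hv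
  simp only [Finset.mem_filter, Finset.mem_univ, true_and] at hx hy hz
  have hx' := hadj x
  have hy' := hadj y
  have hz' := hadj z
  simp only [hx, hy, hz] at hx' hy' hz'
  rcases hF.eq_of_adj hx' hy' hz' with h1 | h1 | h1
  · exact hxy (hpinj _ _ h1)
  · exact hxz (hpinj _ _ h1)
  · exact hyz (hpinj _ _ h1)

end PathFactor

theorem theorem8 (n r : ℕ) :
    (∀ (V : Type*) [Finite V] (G : SimpleGraph V),
      PathFactor.IsKConnected (n + r + 2) G →
      ((((n : ℝ) + 3 * ((r : ℝ) + 2)) / (2 * ((r : ℝ) + 2)) : ℝ) : EReal)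
        < PathFactor.isolatedToughness G →
      PathFactor.IsFactorCriticalAvoidable 3 n G) ∧
    (PathFactor.IsKConnected (n + r + 2) (PathFactor.completeJoinK2 (n + r + 2) (2 * r + 4)) ∧
      PathFactor.isolatedToughness (PathFactor.completeJoinK2 (n + r + 2) (2 * r + 4))
        = ((((n : ℝ) + 3 * ((r : ℝ) + 2)) / (2 * ((r : ℝ) + 2)) : ℝ) : EReal) ∧
      ¬ PathFactor.IsFactorCriticalAvoidable 3 n
        (PathFactor.completeJoinK2 (n + r + 2) (2 * r + 4))) ∧
    (1 ≤ n →
      PathFactor.IsKConnected (n + r + 1) (PathFactor.completeJoinK2 (n + r + 1) (2 * r + 2)) ∧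
      ((((n : ℝ) + 3 * ((r : ℝ) + 2)) / (2 * ((r : ℝ) + 2)) : ℝ) : EReal)
        < PathFactor.isolatedToughness (PathFactor.completeJoinK2 (n + r + 1) (2 * r + 2)) ∧
      ¬ PathFactor.IsFactorCriticalAvoidable 3 n
        (PathFactor.completeJoinK2 (n + r + 1) (2 * r + 2))) := by
  have hr : (0 : ℝ) < (r : ℝ) + 2 := by positivity
  refine ⟨fun V _ G hG hI => PathFactor.isFactorCriticalAvoidable_of_isolatedToughness hG hI,
    ⟨PathFactor.isKConnected_completeJoinK2 (by omega), ?_,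
      PathFactor.not_isFactorCriticalAvoidable_completeJoinK2 (s := r + 2) (by omega) (by omega)
        (by omega)⟩,
    fun hn => ⟨PathFactor.isKConnected_completeJoinK2 (by omega), ?_,
      PathFactor.not_isFactorCriticalAvoidable_completeJoinK2 (s := r + 1) (by omega) (by omega)
        (by omega)⟩⟩
  · rw [PathFactor.isolatedToughness_completeJoinK2 (by omega), EReal.coe_eq_coe_iff,
      div_eq_div_iff (by positivity) (by positivity)]
    push_cast
    ring
  -- The comparison is `3/2 + n/(2(r + 1)) > 3/2 + n/(2(r + 2))`, where `n ≥ 1` is essential.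
  · rw [PathFactor.isolatedToughness_completeJoinK2 (by omega), EReal.coe_lt_coe_iff,
      div_lt_div_iff₀ (by positivity) (by positivity)]
    have hn' : (1 : ℝ) ≤ n := by exact_mod_cast hn
    push_cast
    nlinarith
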